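/- **Setting.** Let $\mathcal X\subset\mathbb R^{d_0}$ be bounded and $B_x=\sup_{x\in\mathcal X}\|x\|_2$. Let $\rho$ be a discrete probability distribution on a set $\mathcal C$ of classes with $\rho(c)<1$ for every $c\in\mathcal C$, let $\mathcal D_c$ $(c\in\mathcal C)$ be probability distributions on $\mathcal X$, and put $\bar{\mathcal D}_c=\frac{\sum_{z\neq c}\rho(z)\mathcal D_z}{\sum_{z\neq c}\rho(z)}$. An input tuple $(x,x^+,x_1^-,\dots,x_k^-)$ is drawn by drawing $c\sim\rho$ and then, independently given $c$, $x,x^+\sim\mathcal D_c$ and $x_1^-,\dots,x_k^-\sim\bar{\mathcal D}_c$. For a loss $\ell:\mathbb R^k\to[0,M]$ and a representation function $f$ let $$\mathrm{L_{un}}(f)=\mathbb E\Big[\ell\big(\{f(x)^\top(f(x^+)-f(x_i^-))\}_{i=1}^k\big)\Big],\qquad \widehat{\mathrm L}_{\mathrm{un}}(f)=\frac1n\sum_{j=1}^n\ell\big(\{f(x_j)^\top(f(x_j^+)-f(x_{ji}^-))\}_{i=1}^k\big),$$ where $(x_j,x_j^+,x_{j1}^-,\dots,x_{jk}^-)$,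 $1\le j\le n$ $(n\ge 1)$, are i.i.d. input tuples. Let $L\ge1$, let $d_1,\dots,d_L$ be natural numbers, and for $1\le l\le L$ let $M^{(l)}\in\mathbb R^{d_l\times d_{l-1}}$ be a fixed reference matrix, $a_l,s_l>0$, and let $\sigma_l:\mathbb R^{d_l}\to\mathbb R^{d_l}$ be $\rho_l$-Lipschitz for the Euclidean norm with $\sigma_l(0)=0$. Let $\mathcal F_{\mathcal A}$ be the class of all networks $$F_{\mathbf A}(x)=\sigma_L\big(A^{(L)}\sigma_{L-1}(\cdots\sigma_1(A^{(1)}x)\cdots)\big),\qquad \|A^{(l)}\|_\sigma\le s_l,\quad \|(A^{(l)}-M^{(l)})^\top\|_{2,1}\le a_l\quad(1\le l\le L),$$ where $\|\cdot\|_\sigma$ is the spectral norm and $\|\cdot\|_{2,1}$ is the sum of the $\ell^2$ norms of the columns. Let $W=\max_{1\le l\le L}d_l$. **Theorem.** There is a universal constant $C>0$ such that, in every such setting, if $\ell$ satisfies $|\ell(v)-\ell(\bar v)|\le\eta\|v-\bar v\|_\infty$ for all $v,\bar v\in\mathbb R^k$, with $\eta>0$, then for every $\delta\in(0,1)$, with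 probability at least $1-\delta$ over the sample, every $F_{\mathbf A}\in\mathcal F_{\mathcal A}$ satisfies $$\mathrm{L_{un}}(F_{\mathbf A})-\widehat{\mathrm L}_{\mathrm{un}}(F_{\mathbf A})\le 3M\sqrt{\frac{\log(2/\delta)}{2n}}+C\,\sqrt{\log(n(k+2))}\,\log(n+1)\cdot\frac{\eta B_x^2}{\sqrt n}\,\log(\max\{W,2\})\prod_{m=1}^L\rho_m^2s_m^2\Bigg[\sum_{l=1}^L\frac{a_l^{2/3}}{s_l^{2/3}}\Bigg]^{3/2}.$$ -/

import Mathlib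

open MeasureTheory
open scoped NNReal ENNReal Matrix

noncomputable section

namespace DCRL

/-- Euclidean space `ℝ^m` with its `ℓ²` norm. -/
abbrev Euc (m : ℕ) : Type := EuclideanSpace ℝ (Fin m)

/-- The spectral norm of a matrix: its operator norm with respect to the Euclidean norms. -/
def specNorm {p q : ℕ} (A : Matrix (Fin p) (Fin q) ℝ) : ℝ :=
  ‖LinearMap.toContinuousLinearMap (Matrix.toEuclideanLin A)‖

/-- The `(2,1)` norm of a matrix: the sum of the `ℓ²` norms of its columns. -/
def norm21 {p q : ℕ} (A : Matrix (Fin p) (Fin q) ℝ) : ℝ :=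
  ∑ j, √(∑ i, A i j ^ 2)

/-- The parameter space of one layer: the matrices `A` with `‖A‖_σ ≤ s` and
`‖(A - M)ᵀ‖_{2,1} ≤ a`, where `M` is the reference matrix. -/
def layerSpace {p q : ℕ} (M : Matrix (Fin p) (Fin q) ℝ) (s a : ℝ) :
    Set (Matrix (Fin p) (Fin q) ℝ) :=
  {A | specNorm A ≤ s ∧ norm21 (A - M)ᵀ ≤ a}

/-- The network with weights `A` truncated after `l` layers. The data of the layer from
`ℝ^(d l)` to `ℝ^(d (l+1))`, which is layer number `l + 1`, carry the index `l`. -/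
def network (d : ℕ → ℕ) (act : ∀ l, Euc (d (l + 1)) → Euc (d (l + 1)))
    (A : ∀ l, Matrix (Fin (d (l + 1))) (Fin (d l)) ℝ) : ∀ l, Euc (d 0) → Euc (d l)
  | 0, x => x
  | l + 1, x => act l (Matrix.toEuclideanLin (A l) (network d act A l x))

/-- The class of `L`-layer networks whose weights lie in the product of the layer spaces. -/
def networkClass (L : ℕ) (d : ℕ → ℕ) (act : ∀ l, Euc (d (l + 1)) → Euc (d (l + 1)))
    (M : ∀ l, Matrix (Fin (d (l + 1))) (Fin (d l)) ℝ) (s a : ℕ → ℝ) :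
    Set (Euc (d 0) → Euc (d L)) :=
  {f | ∃ A : ∀ l, Matrix (Fin (d (l + 1))) (Fin (d l)) ℝ,
    (∀ l < L, A l ∈ layerSpace (M l) (s l) (a l)) ∧ f = network d act A L}

/-- The maximum width `W = max_{1 ≤ l ≤ L} d_l`. -/
def maxWidth (L : ℕ) (d : ℕ → ℕ) : ℕ :=
  (Finset.range L).sup fun l => d (l + 1)

/-- An input tuple `(x, x⁺, (x⁻_1, …, x⁻_k))`. -/
abbrev InputTuple (m k : ℕ) : Type := Euc m × Euc m × (Fin k → Euc m)

/-- The distribution of a negative sample for class `c`: the mixture of the `D z`, `z ≠ c`,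
with weights proportional to `ρ z`. -/
def negLaw {𝒞 : Type*} {m : ℕ} (ρ : PMF 𝒞) (D : 𝒞 → Measure (Euc m)) (c : 𝒞) :
    Measure (Euc m) :=
  (∑' z : {z : 𝒞 // z ≠ c}, ρ z)⁻¹ • Measure.sum fun z : {z : 𝒞 // z ≠ c} => ρ z • D z

/-- The law of an input tuple: draw a class `c` from `ρ`, then independently `x, x⁺` from `D c`
and `x⁻_1, …, x⁻_k` from `negLaw ρ D c`. -/
def tupleLaw {𝒞 : Type*} {m : ℕ} (k : ℕ) (ρ : PMF 𝒞) (D : 𝒞 → Measure (Euc m)) :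
    Measure (InputTuple m k) :=
  Measure.sum fun c =>
    ρ c • (D c).prod ((D c).prod (Measure.pi fun _ : Fin k => negLaw ρ D c))

/-- The loss of a representation function on an input tuple. -/
def tupleLoss {m p k : ℕ} (loss : (Fin k → ℝ) → ℝ) (f : Euc m → Euc p)
    (t : InputTuple m k) : ℝ :=
  loss fun i => inner ℝ (f t.1) (f t.2.1 - f (t.2.2 i))

/-- The population unsupervised risk. -/
def popRisk {𝒞 : Type*} {m p k : ℕ} (ρ : PMF 𝒞) (D : 𝒞 → Measure (Euc m))
    (loss : (Fin k → ℝ) → ℝ) (f : Euc m → Euc p) : ℝ :=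
  ∫ t, tupleLoss loss f t ∂(tupleLaw k ρ D)

/-- The empirical unsupervised risk on the data set `S` of `n` input tuples. -/
def empRisk {m p k n : ℕ} (loss : (Fin k → ℝ) → ℝ) (f : Euc m → Euc p)
    (S : Fin n → InputTuple m k) : ℝ :=
  (1 / n : ℝ) * ∑ j, tupleLoss loss f (S j)

end DCRL

end

/-!
The proof splits into a concentration part and an entropy part.

Concentration: by continuity in the weights and separability, it is enough to treat finitely many
networks. For these the supremum of the deviations `popRisk - empRisk` is a function of the sample
with bounded differences, so it exceeds its mean only by the first term of the bound
(`hasSubgaussianMGF_of_bounded_differences`), and its mean is at most twice the Rademacher average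
of the loss vectors (`integral_iSup_mean_sub_le`). As the inputs are bounded, the Rademacher average
is controlled on almost every sample, and no second, empirical, concentration step is needed.

Entropy: the Rademacher average is bounded by chaining over dyadic scales
(`rademacher_le_of_covers`), from covers of the loss vectors in the sup norm. The loss is Lipschitz
in the outputs of the network on the `n (k + 2)` inputs of the sample, so one covers the networks on
these inputs. A layer is covered by a greedy argument that does not see the input dimension
(`exists_moves`, `exists_cover_functionals`): a row of the weight matrix is approximated by
successive steps along data points, each of which lowers a squared norm by a fixed amount, and the
numbers of steps given to the rows are proportional to their norms, whose sum is at most `a`. Hence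
a budget of `q` letters from an alphabet of size `1 + r (2 N + 1) ^ 4`, with `r` the number of rows
and `N` the number of points, gives the accuracy `4 a b / √(q + 1)` on inputs of norm at most `b`.
The layers are composed with errors amplified by the later Lipschitz constants, and the budgets
`q l` proportional to `(a l / s l) ^ (2 / 3)` yield the factor
`(∑ (a l / s l) ^ (2 / 3)) ^ (3 / 2)` (`exists_cover_network`). The same cover with budget zero
bounds the diameter of the class by that factor, which is why the number of chaining scales is
logarithmic in `n` alone.
-/

noncomputable section

namespace DCRL

/-! ### Sup-norm covers of families of linear functionals -/

variable {E : Type*} [NormedAddCommGroup E] [InnerProductSpace ℝ E]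

/-- One move of the greedy approximation by signed data points: stay (`none`), or add or subtract
the data point `x j`. -/
def moveVec {N : ℕ} (x : Fin N → E) : Option (Fin N × Bool) → E
  | none => 0
  | some (j, true) => x j
  | some (j, false) => -x j

/-- Dimension-free sup-norm approximation of a linear functional. As long as some value
`⟪u, x j⟫` exceeds `ε`, subtracting `± (ε / b²) • x j` lowers `‖u‖²` by at least `ε² / b²`, so
the number of moves needed is at most `‖u‖² b² / ε²`, whatever the dimension. -/
theorem exists_moves {N : ℕ} {x : Fin N → E} {b ε : ℝ} (hb : 0 < b) (hε : 0 < ε)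
    (hx : ∀ j, ‖x j‖ ≤ b) (T : ℕ) (u : E) (hu : ‖u‖ ^ 2 * b ^ 2 ≤ T * ε ^ 2) :
    ∃ m : Fin T → Option (Fin N × Bool),
      ∀ j, |inner ℝ (u - (ε / b ^ 2) • ∑ t, moveVec x (m t)) (x j)| ≤ ε := by
  induction T generalizing u with
  | zero =>
    refine ⟨Fin.elim0, fun j => ?_⟩
    have h0 : ‖u‖ ^ 2 * b ^ 2 = 0 := le_antisymm (by simpa using hu) (by positivity)
    have hu0 : u = 0 := by
      rcases mul_eq_zero.1 h0 with h | h
      · simpa using h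
      · exact absurd h (by positivity)
    simp [hu0, hε.le]
  | succ T ih =>
    by_cases hall : ∀ j, |inner ℝ u (x j)| ≤ ε
    · exact ⟨fun _ => none, fun j => by simpa [moveVec] using hall j⟩
    push Not at hall
    obtain ⟨j, hj⟩ := hall
    have key : ∃ p : Bool, ε ≤ inner ℝ u (moveVec x (some (j, p))) := by
      rcases lt_abs.1 hj with h | h
      · exact ⟨true, h.le⟩
      · exact ⟨false, by simpa [moveVec] using h.le⟩
    obtain ⟨p, hp⟩ := key
    set y := moveVec x (some (j, p)) with hy
    have hyb : ‖y‖ ≤ b := by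
      rcases p with _ | _ <;> simpa [hy, moveVec] using hx j
    have hdec : ‖u - (ε / b ^ 2) • y‖ ^ 2 * b ^ 2 ≤ T * ε ^ 2 := by
      rw [norm_sub_sq_real, inner_smul_right, norm_smul, Real.norm_of_nonneg (by positivity)]
      have h1 : ‖y‖ ^ 2 ≤ b ^ 2 := pow_le_pow_left₀ (norm_nonneg _) hyb 2
      have e1 : (‖u‖ ^ 2 - 2 * (ε / b ^ 2 * inner ℝ u y) + (ε / b ^ 2 * ‖y‖) ^ 2) * b ^ 2
          = ‖u‖ ^ 2 * b ^ 2 - 2 * ε * inner ℝ u y + ε ^ 2 * (‖y‖ ^ 2 / b ^ 2) := by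
        field_simp
      have h2 : ‖y‖ ^ 2 / b ^ 2 ≤ 1 := by
        rw [div_le_one (by positivity)]; exact h1
      have h3 : ε ^ 2 * (‖y‖ ^ 2 / b ^ 2) ≤ ε ^ 2 * 1 := by gcongr
      have h4 : ε * ε ≤ ε * inner ℝ u y := by gcongr
      push_cast at hu
      rw [e1]
      nlinarith
    obtain ⟨m, hm⟩ := ih _ hdec
    refine ⟨Fin.cons (some (j, p)) m, fun i => ?_⟩
    have := hm i
    rw [Fin.sum_univ_succ]
    simpa [smul_add, sub_sub, ← hy] using this

/-- The vectors `w i` coded by a word of length `q`: each letter names a coordinate and four moves,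
and the step length for the coordinate `i` is `√k * c`, where `k` is the number of letters that
name `i`. -/
def decode {N r q : ℕ} (x : Fin N → E) (c : ℝ)
    (ω : Fin q → Option (Fin r × (Fin 4 → Option (Fin N × Bool)))) (i : Fin r) : E :=
  (√(∑ t, (ω t).elim (0 : ℝ) fun z => if z.1 = i then 1 else 0) * c) •
    ∑ t, (ω t).elim 0 fun z => if z.1 = i then ∑ s, moveVec x (z.2 s) else 0

theorem sum_elim_extend {τ κ β α : Type*} [Fintype τ] [Fintype κ] [AddCommMonoid α] (e : κ ↪ τ)
    (g : κ → β) (F : β → α) :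
    ∑ t, (Function.extend e (fun z => some (g z)) (fun _ => none) t).elim 0 F = ∑ z, F (g z) := by
  symm
  refine Fintype.sum_of_injective e e.injective _ _ (fun t ht => ?_) fun z => ?_
  · rw [Function.extend_apply' _ _ _ (by simpa using ht), Option.elim_none]
  · rw [e.injective.extend_apply, Option.elim_some]

/-- Every choice of `k i` groups of four moves for each coordinate `i`, with at most `q` groups in
all, is coded by a word of length `q`. -/
theorem exists_decode_eq {N r q : ℕ} (x : Fin N → E) (c : ℝ) (k : Fin r → ℕ)
    (hk : ∑ i, k i ≤ q) (m : ∀ i, Fin (k i) → Fin 4 → Option (Fin N × Bool)) :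
    ∃ ω : Fin q → Option (Fin r × (Fin 4 → Option (Fin N × Bool))),
      ∀ i, decode x c ω i = (√(k i) * c) • ∑ t, ∑ s, moveVec x (m i t s) := by
  obtain ⟨e⟩ : Nonempty ((Σ i, Fin (k i)) ↪ Fin q) :=
    Function.Embedding.nonempty_of_card_le (by simpa using hk)
  refine ⟨Function.extend e (fun z => some (z.1, m z.1 z.2)) fun _ => none, fun i => ?_⟩
  unfold decode
  rw [sum_elim_extend e, sum_elim_extend e, Fintype.sum_sigma, Fintype.sum_sigma]
  congr 1
  · congr 2
    rw [Finset.sum_eq_single i] <;> simp +contextual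
  · rw [Finset.sum_eq_single i] <;> simp +contextual

/-- Sup-norm covering of families of linear functionals whose norms sum to at most `a`: on `N`
points of norm at most `b`, `(1 + r (2 N + 1) ^ 4) ^ q` families approximate all of them up to
`2 a b / √(q + 1)` in `ℓ²`. The functional `u i` is given the share `k i = ⌊q ‖u i‖ / a⌋` of the
budget `q`, the accuracy `√(k i) a b / q`, and `4 k i` greedy moves. -/
theorem exists_cover_functionals {N r : ℕ} {x : Fin N → E} {a b : ℝ} (ha : 0 < a) (hb : 0 < b)
    (hx : ∀ j, ‖x j‖ ≤ b) (q : ℕ) :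
    ∃ 𝒲 : Finset (Fin r → E), 𝒲.card ≤ (1 + r * (2 * N + 1) ^ 4) ^ q ∧
      ∀ u : Fin r → E, ∑ i, ‖u i‖ ≤ a → ∃ w ∈ 𝒲, ∀ j,
        ∑ i, (inner ℝ (u i - w i) (x j)) ^ 2 ≤ (2 * a * b) ^ 2 / (q + 1) := by
  classical
  set c : ℝ := a / (q * b) with hc
  refine ⟨Finset.univ.image fun ω : Fin q → _ => decode x c ω, ?_, fun u hu => ?_⟩
  · refine Finset.card_image_le.trans ?_
    simp [add_comm, mul_comm]
  have hinner : ∀ i j, (inner ℝ (u i) (x j)) ^ 2 ≤ ‖u i‖ ^ 2 * b ^ 2 := fun i j => by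
    rw [← mul_pow, ← sq_abs]
    exact pow_le_pow_left₀ (abs_nonneg _) ((abs_real_inner_le_norm _ _).trans
      (mul_le_mul_of_nonneg_left (hx j) (norm_nonneg _))) 2
  have hui : ∀ i, ‖u i‖ ≤ a := fun i =>
    (Finset.single_le_sum (f := fun i => ‖u i‖) (fun _ _ => norm_nonneg _)
      (Finset.mem_univ i)).trans hu
  rcases Nat.eq_zero_or_pos q with rfl | hq
  · refine ⟨_, Finset.mem_image_of_mem _ (Finset.mem_univ Fin.elim0), fun j => ?_⟩
    have h1 : ∑ i, (inner ℝ (u i) (x j)) ^ 2 ≤ a ^ 2 * b ^ 2 := by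
      calc ∑ i, (inner ℝ (u i) (x j)) ^ 2 ≤ ∑ i, ‖u i‖ * (a * b ^ 2) :=
            Finset.sum_le_sum fun i _ => (hinner i j).trans (by
              nlinarith [mul_le_mul_of_nonneg_left (hui i)
                (mul_nonneg (norm_nonneg (u i)) (sq_nonneg b))])
        _ ≤ a * (a * b ^ 2) := by rw [← Finset.sum_mul]; gcongr
        _ = a ^ 2 * b ^ 2 := by ring
    simp only [decode, Finset.univ_eq_empty, Finset.sum_empty, smul_zero, sub_zero]
    refine h1.trans ?_
    have : 0 ≤ a ^ 2 * b ^ 2 := by positivity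
    norm_num
    nlinarith
  have hq0 : (0 : ℝ) < q := by exact_mod_cast hq
  have hq1 : (1 : ℝ) ≤ q := by exact_mod_cast hq
  let k : Fin r → ℕ := fun i => ⌊q * ‖u i‖ / a⌋₊
  have hk_le : ∀ i, (k i : ℝ) ≤ q * ‖u i‖ / a := fun i => Nat.floor_le (by positivity)
  have hk_lt : ∀ i, ‖u i‖ * q < (k i + 1) * a := fun i => by
    have := Nat.lt_floor_add_one (q * ‖u i‖ / a)
    rw [div_lt_iff₀ ha] at this
    linarith
  have hksum' : (∑ i, (k i : ℝ)) ≤ q := by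
    calc (∑ i, (k i : ℝ)) ≤ ∑ i, q * ‖u i‖ / a := Finset.sum_le_sum fun i _ => hk_le i
      _ = q * (∑ i, ‖u i‖) / a := by rw [Finset.mul_sum, Finset.sum_div]
      _ ≤ q * a / a := by gcongr
      _ = q := by field_simp
  have hksum : ∑ i, k i ≤ q := by exact_mod_cast hksum'
  have hrow : ∀ i, ∃ m : Fin (k i) → Fin 4 → Option (Fin N × Bool), ∀ j,
      (inner ℝ (u i - (√(k i) * c) • ∑ t, ∑ s, moveVec x (m t s)) (x j)) ^ 2
        ≤ k i * (a * b / q) ^ 2 + ‖u i‖ * (a * b ^ 2 / q) := by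
    intro i
    have hlt := hk_lt i
    -- a functional that receives no budget is replaced by zero, and is small
    rcases Nat.eq_zero_or_pos (k i) with h0 | hpos
    · refine ⟨fun _ _ => none, fun j => ?_⟩
      simp only [h0, CharP.cast_eq_zero, zero_add, one_mul, Real.sqrt_zero, zero_mul,
        zero_smul, sub_zero] at hlt ⊢
      refine (hinner i j).trans ?_
      have : ‖u i‖ ≤ a / q := by rw [le_div_iff₀ hq0]; exact hlt.le
      calc ‖u i‖ ^ 2 * b ^ 2 = ‖u i‖ * (‖u i‖ * b ^ 2) := by ring
        _ ≤ ‖u i‖ * (a / q * b ^ 2) := by gcongr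
        _ = _ := by ring
    · have hk1 : (1 : ℝ) ≤ k i := by exact_mod_cast hpos
      have hε : 0 < √(k i) * (a * b / q) := by positivity
      have hbud : ‖u i‖ ^ 2 * b ^ 2 ≤ ((k i * 4 : ℕ) : ℝ) * (√(k i) * (a * b / q)) ^ 2 := by
        rw [mul_pow, Real.sq_sqrt (by positivity)]
        have h2 : ‖u i‖ ≤ 2 * k i * a / q := by
          rw [le_div_iff₀ hq0]; nlinarith
        calc ‖u i‖ ^ 2 * b ^ 2 ≤ (2 * k i * a / q) ^ 2 * b ^ 2 := by gcongr
          _ = _ := by push_cast; ring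
      obtain ⟨m, hm⟩ := exists_moves hb hε hx (k i * 4) (u i) hbud
      refine ⟨fun t s => m (finProdFinEquiv (t, s)), fun j => ?_⟩
      have hstep : √(k i) * (a * b / q) / b ^ 2 = √(k i) * c := by
        rw [hc]; field_simp
      have hsum : ∑ t, ∑ s, moveVec x (m (finProdFinEquiv (t, s))) = ∑ t, moveVec x (m t) := by
        rw [← Fintype.sum_prod_type' fun t s => moveVec x (m (finProdFinEquiv (t, s)))]
        exact finProdFinEquiv.sum_comp fun t => moveVec x (m t)
      rw [hsum, ← hstep]
      have := pow_le_pow_left₀ (abs_nonneg _) (hm j) 2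
      rw [sq_abs, mul_pow √(k i : ℝ), Real.sq_sqrt (by positivity)] at this
      exact this.trans (le_add_of_nonneg_right (by positivity))
  choose m hm using hrow
  obtain ⟨ω, hω⟩ := exists_decode_eq x c k hksum m
  refine ⟨_, Finset.mem_image_of_mem _ (Finset.mem_univ ω), fun j => ?_⟩
  simp only [hω]
  calc _ ≤ ∑ i, (k i * (a * b / q) ^ 2 + ‖u i‖ * (a * b ^ 2 / q)) :=
        Finset.sum_le_sum fun i _ => hm i j
    _ = (∑ i, (k i : ℝ)) * (a * b / q) ^ 2 + (∑ i, ‖u i‖) * (a * b ^ 2 / q) := by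
        rw [Finset.sum_add_distrib, Finset.sum_mul, Finset.sum_mul]
    _ ≤ q * (a * b / q) ^ 2 + a * (a * b ^ 2 / q) := by gcongr
    _ = 2 * (a * b) ^ 2 / q := by field_simp; ring
    _ ≤ (2 * a * b) ^ 2 / (q + 1) := by
        rw [div_le_div_iff₀ hq0 (by positivity)]
        nlinarith [sq_nonneg (a * b)]

/-! ### Covers of layers and of networks -/

/-- A cover by arbitrary centres can be replaced by a cover by members of `S`, not larger, in which
every member of `S` shares a centre with its representative. -/
theorem exists_internal_cover {α β : Type*} (S : Set α) (P : α → β → Prop) (𝒲 : Finset β)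
    (h : ∀ A ∈ S, ∃ w ∈ 𝒲, P A w) :
    ∃ 𝒱 : Finset α, ↑𝒱 ⊆ S ∧ 𝒱.card ≤ 𝒲.card ∧
      ∀ A ∈ S, ∃ A' ∈ 𝒱, ∃ w, P A w ∧ P A' w := by
  classical
  rcases S.eq_empty_or_nonempty with rfl | ⟨A₀, hA₀⟩
  · exact ⟨∅, by simp, by simp, by simp⟩
  have hrep : ∀ w, ∃ A ∈ S, (∃ A' ∈ S, P A' w) → P A w := fun w => by
    by_cases hw : ∃ A' ∈ S, P A' w
    · obtain ⟨A', hA', hP⟩ := hw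
      exact ⟨A', hA', fun _ => hP⟩
    · exact ⟨A₀, hA₀, fun h => absurd h hw⟩
  choose rep hrepS hrepP using hrep
  refine ⟨𝒲.image rep, ?_, Finset.card_image_le, fun A hA => ?_⟩
  · intro A hA
    obtain ⟨w, -, rfl⟩ := Finset.mem_image.1 (Finset.mem_coe.1 hA)
    exact hrepS w
  · obtain ⟨w, hw, hP⟩ := h A hA
    exact ⟨rep w, Finset.mem_image_of_mem _ hw, w, hP, hrepP w ⟨A, hA, hP⟩⟩

theorem norm_toEuclideanLin_le {p r : ℕ} (A : Matrix (Fin r) (Fin p) ℝ) (v : Euc p) :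
    ‖Matrix.toEuclideanLin A v‖ ≤ specNorm A * ‖v‖ :=
  (LinearMap.toContinuousLinearMap (Matrix.toEuclideanLin A)).le_opNorm v

theorem toEuclideanLin_ofLp_apply {p r : ℕ} (A : Matrix (Fin r) (Fin p) ℝ) (v : Euc p)
    (i : Fin r) : Matrix.toEuclideanLin A v i = inner ℝ (WithLp.toLp 2 (A i)) v := by
  simp [Matrix.toLpLin_apply, Matrix.mulVec, dotProduct, PiLp.inner_apply, mul_comm]

theorem norm_toEuclideanLin_sub_sq {p r : ℕ} (A : Matrix (Fin r) (Fin p) ℝ) (w : Fin r → Euc p)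
    (v : Euc p) :
    ‖Matrix.toEuclideanLin A v - WithLp.toLp 2 (fun i => inner ℝ (w i) v)‖ ^ 2
      = ∑ i, (inner ℝ (WithLp.toLp 2 (A i) - w i) v) ^ 2 := by
  rw [EuclideanSpace.norm_sq_eq]
  refine Finset.sum_congr rfl fun i _ => ?_
  rw [Real.norm_eq_abs, sq_abs, inner_sub_left, PiLp.sub_apply, toEuclideanLin_ofLp_apply]

theorem norm21_transpose {p r : ℕ} (A : Matrix (Fin r) (Fin p) ℝ) :
    norm21 Aᵀ = ∑ i, ‖(WithLp.toLp 2 (A i) : Euc p)‖ := by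
  simp [norm21, EuclideanSpace.norm_eq]

/-- Covering of one layer: on `N` inputs of norm at most `b`, the layer space is covered, up to
`4 a b / √(q + 1)` in the outputs, by `(1 + r (2 N + 1) ^ 4) ^ q` of its own members. The input
dimension `p` does not enter. -/
theorem exists_cover_layer {N p r : ℕ} {x : Fin N → Euc p} {a b : ℝ} (s : ℝ)
    (M : Matrix (Fin r) (Fin p) ℝ) (ha : 0 < a) (hb : 0 ≤ b) (hx : ∀ j, ‖x j‖ ≤ b) (q : ℕ) :
    ∃ 𝒱 : Finset (Matrix (Fin r) (Fin p) ℝ), ↑𝒱 ⊆ layerSpace M s a ∧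
      𝒱.card ≤ (1 + r * (2 * N + 1) ^ 4) ^ q ∧
      ∀ A ∈ layerSpace M s a, ∃ A' ∈ 𝒱, ∀ j,
        ‖Matrix.toEuclideanLin A (x j) - Matrix.toEuclideanLin A' (x j)‖
          ≤ 4 * a * b / √(q + 1) := by
  obtain ⟨𝒲, hcard, h𝒲⟩ : ∃ 𝒲 : Finset (Fin r → Euc p),
      𝒲.card ≤ (1 + r * (2 * N + 1) ^ 4) ^ q ∧
      ∀ A ∈ layerSpace M s a, ∃ w ∈ 𝒲, ∀ j,
        ∑ i, (inner ℝ (WithLp.toLp 2 ((A - M) i) - w i) (x j)) ^ 2 ≤ (2 * a * b) ^ 2 / (q + 1) := by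
    rcases hb.eq_or_lt with rfl | hb
    · refine ⟨{0}, by simpa using Nat.one_le_pow _ _ (by omega), fun A _ => ⟨0, by simp, ?_⟩⟩
      intro j
      have : x j = 0 := by simpa using hx j
      simp [this]
    · obtain ⟨𝒲, h1, h2⟩ := exists_cover_functionals (r := r) ha hb hx q
      exact ⟨𝒲, h1, fun A hA => h2 _ ((norm21_transpose (A - M)).symm.trans_le hA.2)⟩
  obtain ⟨𝒱, h𝒱S, h𝒱c, h𝒱⟩ := exists_internal_cover (layerSpace M s a)
    (fun A (w : Fin r → Euc p) => ∀ j,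
      ∑ i, (inner ℝ (WithLp.toLp 2 ((A - M) i) - w i) (x j)) ^ 2 ≤ (2 * a * b) ^ 2 / (q + 1)) 𝒲 h𝒲
  refine ⟨𝒱, h𝒱S, h𝒱c.trans hcard, fun A hA => ?_⟩
  obtain ⟨A', hA', w, hw, hw'⟩ := h𝒱 A hA
  refine ⟨A', hA', fun j => ?_⟩
  have key : ∀ A'' : Matrix (Fin r) (Fin p) ℝ,
      (∑ i, (inner ℝ (WithLp.toLp 2 ((A'' - M) i) - w i) (x j)) ^ 2 ≤ (2 * a * b) ^ 2 / (q + 1)) →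
      ‖Matrix.toEuclideanLin (A'' - M) (x j) - WithLp.toLp 2 (fun i => inner ℝ (w i) (x j))‖
        ≤ 2 * a * b / √(q + 1) := by
    intro A'' h
    refine le_of_sq_le_sq ?_ (by positivity)
    rw [norm_toEuclideanLin_sub_sq, div_pow, Real.sq_sqrt (by positivity)]
    exact h
  have hA1 := key A (hw j)
  have hA2 := key A' (hw' j)
  set y : Euc r := WithLp.toLp 2 fun i => inner ℝ (w i) (x j)
  calc ‖Matrix.toEuclideanLin A (x j) - Matrix.toEuclideanLin A' (x j)‖
      = ‖(Matrix.toEuclideanLin (A - M) (x j) - y)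
          - (Matrix.toEuclideanLin (A' - M) (x j) - y)‖ := by
        congr 1
        rw [map_sub, map_sub, LinearMap.sub_apply, LinearMap.sub_apply]
        abel
    _ ≤ 2 * a * b / √(q + 1) + 2 * a * b / √(q + 1) :=
        (norm_sub_le _ _).trans (add_le_add hA1 hA2)
    _ = 4 * a * b / √(q + 1) := by ring

section Network

variable {L : ℕ} {d : ℕ → ℕ} {act : ∀ l, Euc (d (l + 1)) → Euc (d (l + 1))} {lip : ℕ → ℝ≥0}
  {M : ∀ l, Matrix (Fin (d (l + 1))) (Fin (d l)) ℝ} {s a : ℕ → ℝ}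

theorem network_congr {A A' : ∀ l, Matrix (Fin (d (l + 1))) (Fin (d l)) ℝ} {l : ℕ}
    (h : ∀ m < l, A m = A' m) (x : Euc (d 0)) : network d act A l x = network d act A' l x := by
  induction l with
  | zero => rfl
  | succ l ih =>
    simp only [network]
    rw [ih fun m hm => h m (hm.trans l.lt_succ_self), h l l.lt_succ_self]

theorem norm_network_le (hlip : ∀ l < L, LipschitzWith (lip l) (act l))
    (hact : ∀ l < L, act l 0 = 0) {A : ∀ l, Matrix (Fin (d (l + 1))) (Fin (d l)) ℝ} {l : ℕ}
    (hl : l ≤ L) (hA : ∀ m < l, specNorm (A m) ≤ s m) (hs : ∀ l < L, 0 < s l)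
    {x : Euc (d 0)} {B : ℝ} (hx : ‖x‖ ≤ B) :
    ‖network d act A l x‖ ≤ B * ∏ m ∈ Finset.range l, (lip m * s m) := by
  induction l with
  | zero => simpa [network] using hx
  | succ l ih =>
    have ih := ih (l.le_succ.trans hl) fun m hm => hA m (hm.trans l.lt_succ_self)
    have h1 := (hlip l hl).norm_sub_le (Matrix.toEuclideanLin (A l) (network d act A l x)) 0
    rw [hact l hl, sub_zero, sub_zero] at h1
    have hs' := hs l hl
    rw [Finset.prod_range_succ]
    calc ‖network d act A (l + 1) x‖
        ≤ lip l * ‖Matrix.toEuclideanLin (A l) (network d act A l x)‖ := h1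
      _ ≤ lip l * (s l * (B * ∏ m ∈ Finset.range l, (lip m * s m))) := by
          gcongr
          exact (norm_toEuclideanLin_le _ _).trans
            (mul_le_mul (hA l l.lt_succ_self) ih (norm_nonneg _) hs'.le)
      _ = _ := by ring

/-- Covering of the network class, layer by layer: the cover of a layer is built on the outputs of
the covering networks of the layers below, and an error made in a layer is amplified by at most
the Lipschitz constants of the later layers. The budget `q l` of each layer is free. -/
theorem exists_cover_network_of_budget (hlip : ∀ l < L, LipschitzWith (lip l) (act l))
    (hact : ∀ l < L, act l 0 = 0) (hs : ∀ l < L, 0 < s l) (ha : ∀ l < L, 0 < a l)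
    {N : ℕ} {x : Fin N → Euc (d 0)} {B : ℝ} (hB : 0 ≤ B) (hx : ∀ j, ‖x j‖ ≤ B)
    (q : ℕ → ℕ) {l : ℕ} (hl : l ≤ L) :
    ∃ 𝒩 : Finset (∀ l, Matrix (Fin (d (l + 1))) (Fin (d l)) ℝ),
      (∀ A ∈ 𝒩, ∀ m < l, A m ∈ layerSpace (M m) (s m) (a m)) ∧
      𝒩.card ≤ (1 + maxWidth L d * (2 * N + 1) ^ 4) ^ (∑ m ∈ Finset.range l, q m) ∧
      ∀ A : ∀ l, Matrix (Fin (d (l + 1))) (Fin (d l)) ℝ,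
        (∀ m < l, A m ∈ layerSpace (M m) (s m) (a m)) → ∃ A' ∈ 𝒩, ∀ j,
          ‖network d act A l (x j) - network d act A' l (x j)‖ ≤
            B * (∏ m ∈ Finset.range l, (lip m * s m)) *
              ∑ m ∈ Finset.range l, 4 * (a m / s m) / √(q m + 1) := by
  classical
  induction l with
  | zero =>
    exact ⟨{fun _ => 0}, by simp, by simp, fun A _ => ⟨fun _ => 0, by simp, by simp [network]⟩⟩
  | succ l ih =>
    obtain ⟨𝒩, h𝒩S, h𝒩c, h𝒩⟩ := ih (l.le_succ.trans hl)
    set R := B * ∏ m ∈ Finset.range l, ((lip m : ℝ) * s m) with hR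
    have hs' := hs l hl
    have hR0 : 0 ≤ R := mul_nonneg hB (Finset.prod_nonneg fun m hm =>
      mul_nonneg (lip m).2 (hs m ((Finset.mem_range.1 hm).trans hl)).le)
    have hout : ∀ A ∈ 𝒩, ∀ j, ‖network d act A l (x j)‖ ≤ R := fun A hA j =>
      norm_network_le hlip hact (l.le_succ.trans hl) (fun m hm => (h𝒩S A hA m hm).1) hs (hx j)
    have hlayer : ∀ A : ∀ l, Matrix (Fin (d (l + 1))) (Fin (d l)) ℝ,
        ∃ 𝒱 : Finset (Matrix (Fin (d (l + 1))) (Fin (d l)) ℝ), ↑𝒱 ⊆ layerSpace (M l) (s l) (a l) ∧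
        𝒱.card ≤ (1 + d (l + 1) * (2 * N + 1) ^ 4) ^ q l ∧ (A ∈ 𝒩 →
        ∀ V ∈ layerSpace (M l) (s l) (a l), ∃ V' ∈ 𝒱, ∀ j,
          ‖Matrix.toEuclideanLin V (network d act A l (x j))
            - Matrix.toEuclideanLin V' (network d act A l (x j))‖
            ≤ 4 * a l * R / √(q l + 1)) := by
      intro A
      by_cases hA : A ∈ 𝒩
      · obtain ⟨𝒱, h1, h2, h3⟩ := exists_cover_layer (s l) (M l) (ha l hl) hR0 (hout A hA) (q l)
        exact ⟨𝒱, h1, h2, fun _ => h3⟩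
      · exact ⟨∅, by simp, by simp, fun h => absurd h hA⟩
    choose 𝒱 h𝒱S h𝒱c h𝒱 using hlayer
    refine ⟨𝒩.biUnion fun A => (𝒱 A).image fun V => Function.update A l V, ?_, ?_, ?_⟩
    · intro A hA m hm
      simp only [Finset.mem_biUnion, Finset.mem_image] at hA
      obtain ⟨A', hA', V, hV, rfl⟩ := hA
      rcases (Nat.lt_succ_iff_lt_or_eq.1 hm) with h | rfl
      · rw [Function.update_of_ne h.ne]
        exact h𝒩S A' hA' m h
      · rw [Function.update_self]
        exact h𝒱S A' hV
    · calc _ ≤ 𝒩.card * (1 + maxWidth L d * (2 * N + 1) ^ 4) ^ q l := by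
            refine Finset.card_biUnion_le_card_mul _ _ _ fun A _ => ?_
            refine Finset.card_image_le.trans ((h𝒱c A).trans ?_)
            have : d (l + 1) ≤ maxWidth L d :=
              Finset.le_sup (f := fun l => d (l + 1)) (Finset.mem_range.2 hl)
            gcongr
        _ ≤ _ := by
            rw [Finset.sum_range_succ, pow_add]
            gcongr
    · intro A hA
      obtain ⟨A', hA', hAA'⟩ := h𝒩 A fun m hm => hA m (hm.trans l.lt_succ_self)
      obtain ⟨V, hV, hAV⟩ := h𝒱 A' hA' (A l) (hA l l.lt_succ_self)
      refine ⟨Function.update A' l V, ?_, fun j => ?_⟩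
      · simp only [Finset.mem_biUnion, Finset.mem_image]
        exact ⟨A', hA', V, hV, rfl⟩
      simp only [network, Function.update_self]
      rw [network_congr (A := Function.update A' l V) (A' := A')
        (fun m hm => Function.update_of_ne hm.ne _ _)]
      set F := network d act A l (x j)
      set F' := network d act A' l (x j)
      rw [Finset.prod_range_succ, Finset.sum_range_succ, ← mul_assoc, ← hR]
      set T := ∑ m ∈ Finset.range l, 4 * (a m / s m) / √(q m + 1)
      calc ‖act l (Matrix.toEuclideanLin (A l) F) - act l (Matrix.toEuclideanLin V F')‖
          ≤ lip l * ‖Matrix.toEuclideanLin (A l) F - Matrix.toEuclideanLin V F'‖ :=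
            (hlip l hl).norm_sub_le _ _
        _ ≤ lip l * (s l * (R * T) + 4 * a l * R / √(q l + 1)) := by
            gcongr
            calc _ = ‖Matrix.toEuclideanLin (A l) (F - F')
                  + (Matrix.toEuclideanLin (A l) F' - Matrix.toEuclideanLin V F')‖ := by
                  rw [map_sub]; congr 1; abel
              _ ≤ _ := (norm_add_le _ _).trans (add_le_add ((norm_toEuclideanLin_le _ _).trans
                  (mul_le_mul (hA l l.lt_succ_self).1 (hAA' j) (norm_nonneg _) hs'.le)) (hAV j))
        _ = _ := by field_simp

/-- Covering of the network class with the optimal split of the budget over the layers, the share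
of layer `l` being proportional to `(a l / s l) ^ (2 / 3)`. Taking the total share to be `Q + 1 / 2`
leaves at most `Q` after rounding down, and keeps the bound meaningful for `Q = 0`. -/
theorem exists_cover_network (hlip : ∀ l < L, LipschitzWith (lip l) (act l))
    (hact : ∀ l < L, act l 0 = 0) (hs : ∀ l < L, 0 < s l) (ha : ∀ l < L, 0 < a l) (hL : 1 ≤ L)
    {N : ℕ} {x : Fin N → Euc (d 0)} {B : ℝ} (hB : 0 ≤ B) (hx : ∀ j, ‖x j‖ ≤ B) (Q : ℕ) :
    ∃ 𝒩 : Finset (∀ l, Matrix (Fin (d (l + 1))) (Fin (d l)) ℝ),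
      (∀ A ∈ 𝒩, ∀ m < L, A m ∈ layerSpace (M m) (s m) (a m)) ∧
      𝒩.card ≤ (1 + maxWidth L d * (2 * N + 1) ^ 4) ^ Q ∧
      ∀ A : ∀ l, Matrix (Fin (d (l + 1))) (Fin (d l)) ℝ,
        (∀ m < L, A m ∈ layerSpace (M m) (s m) (a m)) → ∃ A' ∈ 𝒩, ∀ j,
          ‖network d act A L (x j) - network d act A' L (x j)‖ ≤
            4 * (B * (∏ m ∈ Finset.range L, (lip m * s m))) *
              (∑ l ∈ Finset.range L, a l ^ (2 / 3 : ℝ) / s l ^ (2 / 3 : ℝ)) ^ (3 / 2 : ℝ)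
                / √(Q + 1 / 2) := by
  set t : ℕ → ℝ := fun l => a l ^ (2 / 3 : ℝ) / s l ^ (2 / 3 : ℝ) with ht
  set S := ∑ l ∈ Finset.range L, t l with hS
  have ht0 : ∀ l ∈ Finset.range L, 0 < t l := fun l hl =>
    div_pos (Real.rpow_pos_of_pos (ha l (Finset.mem_range.1 hl)) _)
      (Real.rpow_pos_of_pos (hs l (Finset.mem_range.1 hl)) _)
  have hS0 : 0 < S := Finset.sum_pos ht0 ⟨0, Finset.mem_range.2 hL⟩
  have hQ : (0 : ℝ) < Q + 1 / 2 := by positivity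
  let q : ℕ → ℕ := fun l => ⌊(Q + 1 / 2) * t l / S⌋₊
  have hq : ∑ l ∈ Finset.range L, q l ≤ Q := by
    have h1 : (∑ l ∈ Finset.range L, (q l : ℝ)) ≤ Q + 1 / 2 := by
      calc (∑ l ∈ Finset.range L, (q l : ℝ)) ≤ ∑ l ∈ Finset.range L, (Q + 1 / 2) * t l / S :=
            Finset.sum_le_sum fun l hl => Nat.floor_le (by have := ht0 l hl; positivity)
        _ = Q + 1 / 2 := by
            rw [← Finset.sum_div, ← Finset.mul_sum, ← hS]; field_simp
    have h2 : ((∑ l ∈ Finset.range L, q l : ℕ) : ℝ) < (Q + 1 : ℕ) := by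
      push_cast; linarith
    exact Nat.lt_succ_iff.1 (by exact_mod_cast h2)
  obtain ⟨𝒩, h1, h2, h3⟩ :=
    exists_cover_network_of_budget (M := M) hlip hact hs ha hB hx q le_rfl
  refine ⟨𝒩, h1, h2.trans (Nat.pow_le_pow_right (by omega) hq), fun A hA => ?_⟩
  obtain ⟨A', hA', h⟩ := h3 A hA
  refine ⟨A', hA', fun j => (h j).trans ?_⟩
  have hR0 : 0 ≤ B * ∏ m ∈ Finset.range L, ((lip m : ℝ) * s m) :=
    mul_nonneg hB (Finset.prod_nonneg fun m hm =>
      mul_nonneg (lip m).2 (hs m (Finset.mem_range.1 hm)).le)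
  have hterm : ∀ l ∈ Finset.range L,
      4 * (a l / s l) / √(q l + 1) ≤ 4 * (t l * (√S / √(Q + 1 / 2))) := by
    intro l hl
    have htl := ht0 l hl
    have hal := ha l (Finset.mem_range.1 hl)
    have hsl := hs l (Finset.mem_range.1 hl)
    have hα : a l / s l = t l * √(t l) := by
      have e : t l = (a l / s l) ^ (2 / 3 : ℝ) := (Real.div_rpow hal.le hsl.le _).symm
      have hp : 0 < a l / s l := div_pos hal hsl
      rw [Real.sqrt_eq_rpow, ← Real.rpow_one_add' htl.le (by norm_num), e,
        ← Real.rpow_mul hp.le]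
      norm_num
    have hfl : √((Q + 1 / 2) * t l / S) ≤ √(q l + 1) :=
      Real.sqrt_le_sqrt (Nat.lt_floor_add_one _).le
    rw [Real.sqrt_div (by positivity), Real.sqrt_mul hQ.le] at hfl
    have hp1 : 0 < √(t l) := Real.sqrt_pos.2 htl
    have hp2 : 0 < √S := Real.sqrt_pos.2 hS0
    have hp3 : 0 < √((Q : ℝ) + 1 / 2) := Real.sqrt_pos.2 hQ
    calc 4 * (a l / s l) / √(q l + 1)
        ≤ 4 * (t l * √(t l)) / (√(Q + 1 / 2) * √(t l) / √S) := by rw [hα]; gcongr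
      _ = _ := by field_simp
  calc _ ≤ (B * ∏ m ∈ Finset.range L, ((lip m : ℝ) * s m)) *
        ∑ l ∈ Finset.range L, 4 * (t l * (√S / √(Q + 1 / 2))) := by
        gcongr with l hl
        exact hterm l hl
    _ = _ := by
        rw [← Finset.mul_sum, ← Finset.sum_mul, ← hS, show (3 / 2 : ℝ) = 1 + 1 / 2 by norm_num,
          Real.rpow_add hS0, Real.rpow_one, ← Real.sqrt_eq_rpow]
        ring

end Network

/-! ### Rademacher averages, Massart's lemma and chaining -/

/-- The sign `1` or `-1` coded by a Boolean. -/
def sgn (b : Bool) : ℝ := if b then 1 else -1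

/-- The Rademacher average `𝔼_σ sup_i ∑_t σ_t v_i(t)` of a family of vectors, over uniform
signs; it is not normalised by `n`. -/
def rademacher {ι : Type*} {n : ℕ} (v : ι → Fin n → ℝ) : ℝ :=
  (∑ σ : Fin n → Bool, ⨆ i, ∑ t, sgn (σ t) * v i t) / 2 ^ n

theorem abs_sgn (b : Bool) : |sgn b| = 1 := by cases b <;> simp [sgn]

theorem sum_exp_signs_le (w : Fin n → ℝ) :
    ∑ σ : Fin n → Bool, Real.exp (∑ t, sgn (σ t) * w t)
      ≤ 2 ^ n * Real.exp ((∑ t, w t ^ 2) / 2) := by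
  calc ∑ σ : Fin n → Bool, Real.exp (∑ t, sgn (σ t) * w t)
      = ∏ t, ∑ b : Bool, Real.exp (sgn b * w t) := by
        rw [Finset.prod_univ_sum, Fintype.piFinset_univ]
        exact Finset.sum_congr rfl fun σ _ => Real.exp_sum _ _
    _ ≤ ∏ t, (2 * Real.exp (w t ^ 2 / 2)) := by
        refine Finset.prod_le_prod (fun _ _ => Finset.sum_nonneg fun _ _ => (Real.exp_pos _).le)
          fun t _ => ?_
        have h := Real.cosh_le_exp_half_sq (w t)
        rw [Real.cosh_eq] at h
        simp [sgn]
        linarith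
    _ = _ := by
        rw [Finset.prod_mul_distrib, ← Real.exp_sum, Finset.sum_div]
        simp

section

variable {ι : Type*} [Nonempty ι] {n : ℕ}

theorem rademacher_add_le [Finite ι] (u v : ι → Fin n → ℝ) :
    rademacher (u + v) ≤ rademacher u + rademacher v := by
  unfold rademacher
  rw [← add_div, ← Finset.sum_add_distrib]
  gcongr with σ
  refine ciSup_le fun i => ?_
  calc ∑ t, sgn (σ t) * (u + v) i t
      = ∑ t, sgn (σ t) * u i t + ∑ t, sgn (σ t) * v i t := by
        rw [← Finset.sum_add_distrib]
        exact Finset.sum_congr rfl fun t _ => by simp [mul_add]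
    _ ≤ _ := add_le_add (le_ciSup (f := fun i => ∑ t, sgn (σ t) * u i t)
        (Set.finite_range _).bddAbove i) (le_ciSup (f := fun i => ∑ t, sgn (σ t) * v i t)
        (Set.finite_range _).bddAbove i)

theorem rademacher_le_of_forall_abs_le {v : ι → Fin n → ℝ} {ε : ℝ} (h : ∀ i t, |v i t| ≤ ε) :
    rademacher v ≤ n * ε := by
  unfold rademacher
  rw [div_le_iff₀ (by positivity)]
  calc ∑ σ : Fin n → Bool, ⨆ i, ∑ t, sgn (σ t) * v i t ≤ ∑ σ : Fin n → Bool, (n * ε : ℝ) := by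
        gcongr with σ
        refine ciSup_le fun i => ?_
        calc ∑ t, sgn (σ t) * v i t ≤ ∑ _t : Fin n, ε := by
              gcongr with t
              refine (le_abs_self _).trans ?_
              rw [abs_mul, abs_sgn, one_mul]
              exact h i t
          _ = n * ε := by simp
    _ = n * ε * 2 ^ n := by simp [mul_comm]

theorem rademacher_const (w : Fin n → ℝ) : rademacher (fun _ : ι => w) = 0 := by
  have h : ∑ σ : Fin n → Bool, ∑ t, sgn (σ t) * w t = 0 := by
    have e : ∑ σ : Fin n → Bool, ∑ t, sgn (σ t) * w t
        = ∑ σ : Fin n → Bool, ∑ t, sgn (!σ t) * w t :=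
      (Equiv.sum_comp (Equiv.arrowCongr (Equiv.refl (Fin n)) Equiv.boolNot)
        fun σ : Fin n → Bool => ∑ t, sgn (σ t) * w t).symm
    have e2 : ∑ σ : Fin n → Bool, ∑ t, sgn (!σ t) * w t
        = - ∑ σ : Fin n → Bool, ∑ t, sgn (σ t) * w t := by
      simp only [← Finset.sum_neg_distrib]
      refine Finset.sum_congr rfl fun σ _ => Finset.sum_congr rfl fun t _ => ?_
      cases σ t <;> simp [sgn]
    linarith
  simp [rademacher, h]

/-- **Massart's finite class lemma**, for a family with at most `exp H` different members. -/
theorem rademacher_le_of_card [Finite ι] {v : ι → Fin n → ℝ} {U : Finset (Fin n → ℝ)} {H r : ℝ}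
    (hU : ∀ i, v i ∈ U) (hH : 0 < H) (hcard : (U.card : ℝ) ≤ Real.exp H) (hr : 0 ≤ r)
    (hv : ∀ i, ∑ t, v i t ^ 2 ≤ r ^ 2) : rademacher v ≤ r * √(2 * H) := by
  classical
  have key : ∀ c : ℝ, 0 < c → c * rademacher v ≤ H + c ^ 2 * r ^ 2 / 2 := by
    intro c hc
    set h := H + c ^ 2 * r ^ 2 / 2 with hh
    let U' := U.filter fun w => ∑ t, w t ^ 2 ≤ r ^ 2
    -- the tangent line bound `1 + y ≤ exp y` plays the role of Jensen's inequality
    have h1 : ∀ σ : Fin n → Bool, 1 + (c * (⨆ i, ∑ t, sgn (σ t) * v i t) - h)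
        ≤ Real.exp (-h) * ∑ w ∈ U', Real.exp (∑ t, sgn (σ t) * (c * w t)) := by
      intro σ
      obtain ⟨i, hi⟩ := exists_eq_ciSup_of_finite (f := fun i => ∑ t, sgn (σ t) * v i t)
      rw [← hi]
      calc 1 + (c * (∑ t, sgn (σ t) * v i t) - h)
          ≤ Real.exp (c * (∑ t, sgn (σ t) * v i t) - h) := by
            linarith [Real.add_one_le_exp (c * (∑ t, sgn (σ t) * v i t) - h)]
        _ = Real.exp (-h) * Real.exp (∑ t, sgn (σ t) * (c * v i t)) := by
            rw [← Real.exp_add, Finset.mul_sum, sub_eq_neg_add]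
            congr 2
            exact Finset.sum_congr rfl fun t _ => by ring
        _ ≤ _ := by
            gcongr
            refine Finset.single_le_sum
              (f := fun w : Fin n → ℝ => Real.exp (∑ t, sgn (σ t) * (c * w t)))
              (fun _ _ => (Real.exp_pos _).le) ?_
            exact Finset.mem_filter.2 ⟨hU i, hv i⟩
    have h2 := Finset.sum_le_sum fun σ (_ : σ ∈ (Finset.univ : Finset (Fin n → Bool))) => h1 σ
    rw [← Finset.mul_sum, Finset.sum_comm] at h2
    have h3 : ∑ w ∈ U', ∑ σ : Fin n → Bool, Real.exp (∑ t, sgn (σ t) * (c * w t))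
        ≤ 2 ^ n * Real.exp h := by
      calc _ ≤ ∑ w ∈ U', 2 ^ n * Real.exp (c ^ 2 * r ^ 2 / 2) := by
            refine Finset.sum_le_sum fun w hw => (sum_exp_signs_le _).trans ?_
            have := (Finset.mem_filter.1 hw).2
            simp only [mul_pow, ← Finset.mul_sum]
            gcongr
        _ = U'.card * (2 ^ n * Real.exp (c ^ 2 * r ^ 2 / 2)) := by simp
        _ ≤ Real.exp H * (2 ^ n * Real.exp (c ^ 2 * r ^ 2 / 2)) := by
            gcongr
            exact le_trans (by exact_mod_cast Finset.card_filter_le _ _) hcard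
        _ = _ := by rw [hh, Real.exp_add]; ring
    have h4 : ∑ σ : Fin n → Bool, (1 + (c * (⨆ i, ∑ t, sgn (σ t) * v i t) - h)) ≤ 2 ^ n := by
      refine h2.trans ((mul_le_mul_of_nonneg_left h3 (Real.exp_pos _).le).trans_eq ?_)
      rw [mul_left_comm, ← Real.exp_add]; simp
    have h5 : ∑ σ : Fin n → Bool, (⨆ i, ∑ t, sgn (σ t) * v i t) = 2 ^ n * rademacher v := by
      unfold rademacher; field_simp
    rw [Finset.sum_add_distrib, Finset.sum_sub_distrib, ← Finset.mul_sum, h5] at h4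
    simp only [Finset.sum_const, Finset.card_univ, Fintype.card_pi, Fintype.card_bool,
      Finset.prod_const, Fintype.card_fin, nsmul_eq_mul, mul_one] at h4
    push_cast at h4
    have hp : (0 : ℝ) < 2 ^ n := by positivity
    nlinarith
  rcases hr.eq_or_lt with rfl | hr
  · have h0 : ∀ i, v i = 0 := fun i => by
      have := (hv i).antisymm (by simpa using Finset.sum_nonneg fun t _ => sq_nonneg (v i t))
      funext t
      have h := (Finset.sum_eq_zero_iff_of_nonneg fun t _ => sq_nonneg (v i t)).1
        (this.trans (by norm_num)) t (Finset.mem_univ t)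
      simpa using h
    have : v = fun _ => 0 := funext h0
    rw [this, rademacher_const]; simp
  · have hs : 0 < √(2 * H) := by positivity
    have hs2 : √(2 * H) ^ 2 = 2 * H := Real.sq_sqrt (by positivity)
    have h := key (√(2 * H) / r) (by positivity)
    have e : (√(2 * H) / r) ^ 2 * r ^ 2 / 2 = H := by
      rw [div_pow, hs2]; field_simp
    rw [e] at h
    have h' : √(2 * H) / r * rademacher v ≤ √(2 * H) / r * (r * √(2 * H)) := by
      refine h.trans_eq ?_
      have e' : √(2 * H) / r * (r * √(2 * H)) = √(2 * H) ^ 2 := by field_simp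
      rw [e', hs2]; ring
    exact le_of_mul_le_mul_left h' (by positivity)

/-- **Chaining**: if the family is covered in the sup norm, at each scale `G / 2 ^ j`, by
`K ^ (4 ^ j / 2)` vectors (so by one vector at scale `G`), then each of the first `J` scales
contributes at most `3 G √(2 n log K)` to the Rademacher average. -/
theorem rademacher_le_of_covers [Finite ι] {v : ι → Fin n → ℝ} {K : ℕ} {G : ℝ}
    (hK : 2 ≤ K) (hG : 0 ≤ G)
    (hcov : ∀ j : ℕ, ∃ C : Finset (Fin n → ℝ), C.card ≤ K ^ (4 ^ j / 2) ∧
      ∀ i, ∃ c ∈ C, ∀ t, |v i t - c t| ≤ G / 2 ^ j) (J : ℕ) :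
    rademacher v ≤ J * (3 * G * √n * √(2 * Real.log K)) + n * (G / 2 ^ J) := by
  classical
  choose C hcard hC using hcov
  choose π hπC hπ using hC
  have hlogK : 0 < Real.log K := Real.log_pos (by exact_mod_cast hK)
  have hKpos : (0 : ℝ) < K := by positivity
  have hmain : rademacher (π J) ≤ J * (3 * G * √n * √(2 * Real.log K)) := by
    induction J with
    | zero =>
      have h1 : (C 0).card ≤ 1 := by simpa using hcard 0
      -- at scale `0` all members share one approximant, whose average vanishes
      let i₀ : ι := Classical.arbitrary ι
      have : π 0 = fun _ => π 0 i₀ :=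
        funext fun i => Finset.card_le_one.1 h1 _ (hπC 0 i) _ (hπC 0 i₀)
      rw [this, rademacher_const]; simp
    | succ J ih =>
      let u : ι → Fin n → ℝ := fun i => π (J + 1) i - π J i
      have hu : rademacher u ≤ 3 * G * √n * √(2 * Real.log K) := by
        have hr : ∀ i, ∑ t, u i t ^ 2 ≤ (√n * (3 * G / 2 ^ (J + 1))) ^ 2 := fun i => by
          rw [mul_pow, Real.sq_sqrt (by positivity)]
          calc ∑ t, u i t ^ 2 ≤ ∑ _t : Fin n, (3 * G / 2 ^ (J + 1)) ^ 2 := by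
                refine Finset.sum_le_sum fun t _ => ?_
                rw [← sq_abs]
                refine pow_le_pow_left₀ (abs_nonneg _) ?_ 2
                have e : u i t = (v i t - π J i t) - (v i t - π (J + 1) i t) := by
                  simp [u]
                rw [e]
                refine (abs_sub _ _).trans ((add_le_add (hπ J i t) (hπ (J + 1) i t)).trans_eq ?_)
                rw [pow_succ]; field_simp; norm_num
            _ = _ := by simp
        have hlog : Real.exp (4 ^ (J + 1) * Real.log K) = (K : ℝ) ^ (4 ^ (J + 1)) := by
          have := Real.exp_nat_mul (Real.log K) (4 ^ (J + 1))
          rw [Real.exp_log hKpos] at this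
          exact_mod_cast this
        have hUcard : (((C (J + 1) ×ˢ C J).image fun p => p.1 - p.2).card : ℝ)
            ≤ Real.exp (4 ^ (J + 1) * Real.log K) := by
          rw [hlog]
          have : ((C (J + 1) ×ˢ C J).image fun p => p.1 - p.2).card ≤ K ^ (4 ^ (J + 1)) := by
            refine Finset.card_image_le.trans ?_
            rw [Finset.card_product]
            refine (Nat.mul_le_mul (hcard _) (hcard _)).trans ?_
            rw [← pow_add]
            refine Nat.pow_le_pow_right (by omega) ?_
            rw [pow_succ]; omega
          exact_mod_cast this
        refine (rademacher_le_of_card (fun i => Finset.mem_image.2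
          ⟨(π (J + 1) i, π J i), Finset.mem_product.2 ⟨hπC _ i, hπC _ i⟩, rfl⟩)
          (by positivity) hUcard (by positivity) hr).trans_eq ?_
        have e4 : (4 : ℝ) ^ (J + 1) = (2 ^ (J + 1)) ^ 2 := by
          rw [← pow_mul, mul_comm, pow_mul]; norm_num
        rw [mul_left_comm, Real.sqrt_mul (by positivity), e4, Real.sqrt_sq (by positivity)]
        field_simp
      have hsplit : π (J + 1) = π J + u := by
        funext i t; simp [u]
      rw [hsplit]
      refine (rademacher_add_le _ _).trans ((add_le_add ih hu).trans_eq ?_)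
      push_cast; ring
  have hsplit : v = π J + (v - π J) := by simp
  rw [hsplit]
  refine (rademacher_add_le _ _).trans (add_le_add hmain ?_)
  exact rademacher_le_of_forall_abs_le fun i t => by simpa using hπ J i t

end

/-! ### The bounded differences inequality -/

theorem integrable_of_forall_abs_le {α : Type*} [MeasurableSpace α] {μ : Measure α}
    [IsFiniteMeasure μ] {f : α → ℝ} (hf : Measurable f) {C : ℝ} (hC : ∀ x, |f x| ≤ C) :
    Integrable f μ :=
  Integrable.of_bound hf.aestronglyMeasurable C (Filter.Eventually.of_forall hC)

theorem integrable_exp_mul_of_forall_abs_le {α : Type*} [MeasurableSpace α] {μ : Measure α}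
    [IsFiniteMeasure μ] {f : α → ℝ} (hf : Measurable f) {C : ℝ} (hC : ∀ x, |f x| ≤ C) (t : ℝ) :
    Integrable (fun x => Real.exp (t * f x)) μ := by
  refine integrable_of_forall_abs_le (C := Real.exp (|t| * C)) (by fun_prop) fun x => ?_
  rw [abs_of_pos (Real.exp_pos _)]
  refine Real.exp_le_exp.2 ((le_abs_self _).trans ?_)
  rw [abs_mul]
  exact mul_le_mul_of_nonneg_left (hC x) (abs_nonneg t)

/-- **McDiarmid's bounded differences inequality**, in the form of a bound on the moment
generating function. The first coordinate is integrated out by Hoeffding's lemma, and the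
partial expectation again has bounded differences. -/
theorem hasSubgaussianMGF_of_bounded_differences {Ω : Type*} [MeasurableSpace Ω] (μ : Measure Ω)
    [IsProbabilityMeasure μ] {n : ℕ} {f : (Fin n → Ω) → ℝ} (hf : Measurable f) {C : ℝ}
    (hC : ∀ x, |f x| ≤ C) {c : ℝ≥0} (hc : ∀ x i y, |f (Function.update x i y) - f x| ≤ c) :
    ProbabilityTheory.HasSubgaussianMGF
      (fun x => f x - ∫ y, f y ∂(Measure.pi fun _ => μ)) (n * c ^ 2 / 4)
      (Measure.pi fun _ => μ) := by
  refine ⟨fun t => ?_, fun t => ?_⟩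
  · refine integrable_exp_mul_of_forall_abs_le
      (C := C + |∫ y, f y ∂(Measure.pi fun _ => μ)|) (hf.sub_const _) (fun x => ?_) t
    exact (abs_sub _ _).trans (add_le_add_left (hC x) _)
  unfold ProbabilityTheory.mgf
  induction n generalizing C with
  | zero =>
    have h0 : ∀ x y, f x = f y := fun x y => by rw [Subsingleton.elim x y]
    have : ∀ x, t * (f x - ∫ y, f y ∂(Measure.pi fun _ => μ)) = 0 := fun x => by
      simp_rw [fun y => h0 y x]; simp
    simp only [this]
    simp
  | succ n ih =>
    set P := Measure.pi fun _ : Fin n => μ with hP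
    have hmp := measurePreserving_piFinSuccAbove (fun _ : Fin (n + 1) => μ) 0
    let e := MeasurableEquiv.piFinSuccAbove (fun _ : Fin (n + 1) => Ω) 0
    have hcons : ∀ p : Ω × (Fin n → Ω), e.symm p = Fin.cons p.1 p.2 := fun p => by
      simp [e, MeasurableEquiv.piFinSuccAbove, Fin.insertNthEquiv]
    have hint : ∀ G : (Fin (n + 1) → Ω) → ℝ,
        ∫ x, G x ∂(Measure.pi fun _ => μ) = ∫ p, G (Fin.cons p.1 p.2) ∂(μ.prod P) := by
      intro G
      rw [← hmp.symm.integral_comp' (f := e.symm)]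
      simp only [hcons]
      rfl
    let F : Ω × (Fin n → Ω) → ℝ := fun p => f (Fin.cons p.1 p.2)
    have hF : Measurable F := by
      have : F = f ∘ e.symm := by funext p; simp [F, hcons]
      rw [this]
      exact hf.comp e.symm.measurable
    have hFC : ∀ p, |F p| ≤ C := fun p => hC _
    let g : (Fin n → Ω) → ℝ := fun y => ∫ a, F (a, y) ∂μ
    have hg : Measurable g := by
      have := hF.stronglyMeasurable.integral_prod_left' (μ := μ)
      exact this.measurable
    have hFy : ∀ y, Measurable fun a => F (a, y) := fun y => by fun_prop
    have hFint : ∀ y, Integrable (fun a => F (a, y)) μ := fun y =>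
      integrable_of_forall_abs_le (hFy y) fun a => hFC _
    have hgC : ∀ y, |g y| ≤ C := fun y => by
      have := norm_integral_le_of_norm_le_const (μ := μ) (f := fun a => F (a, y)) (C := C)
        (Filter.Eventually.of_forall fun a => hFC _)
      simpa using this
    have hgc : ∀ x i y, |g (Function.update x i y) - g x| ≤ c := by
      intro x i y
      rw [← integral_sub (hFint _) (hFint _)]
      have := norm_integral_le_of_norm_le_const (μ := μ)
        (f := fun a => F (a, Function.update x i y) - F (a, x)) (C := c)
        (Filter.Eventually.of_forall fun a => by
          simp only [F, Fin.cons_update]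
          exact hc _ _ _)
      simpa using this
    have hm : ∫ x, f x ∂(Measure.pi fun _ => μ) = ∫ y, g y ∂P := by
      rw [hint f]
      exact integral_prod_symm _ (integrable_of_forall_abs_le hF hFC)
    set m := ∫ y, g y ∂P with hmdef
    have hinner : ∀ y, ∫ a, Real.exp (t * (F (a, y) - g y)) ∂μ
        ≤ Real.exp ((c : ℝ) ^ 2 / 4 * t ^ 2 / 2) := by
      intro y
      have hbdd : BddBelow (Set.range fun a => F (a, y)) :=
        ⟨-C, by rintro _ ⟨a, rfl⟩; exact (abs_le.1 (hFC _)).1⟩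
      have : Nonempty Ω := nonempty_of_isProbabilityMeasure μ
      have hmem : ∀ a, F (a, y) ∈ Set.Icc (⨅ a, F (a, y)) ((⨅ a, F (a, y)) + c) := by
        intro a
        refine ⟨ciInf_le hbdd a, ?_⟩
        have : F (a, y) - c ≤ ⨅ a, F (a, y) := le_ciInf fun a' => by
          have := hc (Fin.cons a' y) 0 a
          rw [Fin.update_cons_zero] at this
          have := (abs_le.1 this).2
          simp only [F]; linarith
        linarith
      have h := (ProbabilityTheory.hasSubgaussianMGF_of_mem_Icc (μ := μ) (hFy y).aemeasurable
        (Filter.Eventually.of_forall hmem)).mgf_le t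
      unfold ProbabilityTheory.mgf at h
      refine h.trans_eq ?_
      congr 1
      simp only [add_sub_cancel_left, NNReal.nnnorm_eq]
      push_cast
      ring
    have hih := ih hg hgC hgc
    have hexpF : Measurable fun p : Ω × (Fin n → Ω) => Real.exp (t * (F p - m)) := by fun_prop
    have hintF : Integrable (fun p : Ω × (Fin n → Ω) => Real.exp (t * (F p - m))) (μ.prod P) :=
      integrable_exp_mul_of_forall_abs_le (C := C + |m|) (hF.sub_const _)
        (fun x => (abs_sub _ _).trans (add_le_add_left (hFC x) _)) t
    have hintg : Integrable (fun y => Real.exp (t * (g y - m))) P :=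
      integrable_exp_mul_of_forall_abs_le (C := C + |m|) (hg.sub_const _)
        (fun x => (abs_sub _ _).trans (add_le_add_left (hgC x) _)) t
    rw [hm, hint]
    calc ∫ p, Real.exp (t * (F p - m)) ∂(μ.prod P)
        = ∫ y, ∫ a, Real.exp (t * (F (a, y) - m)) ∂μ ∂P := integral_prod_symm _ hintF
      _ ≤ ∫ y, Real.exp (t * (g y - m)) * Real.exp ((c : ℝ) ^ 2 / 4 * t ^ 2 / 2) ∂P := by
          refine integral_mono hintF.integral_prod_right (hintg.mul_const _) fun y => ?_
          have : ∀ a, Real.exp (t * (F (a, y) - m))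
              = Real.exp (t * (g y - m)) * Real.exp (t * (F (a, y) - g y)) := fun a => by
            rw [← Real.exp_add]; ring_nf
          simp only [this, integral_const_mul]
          exact mul_le_mul_of_nonneg_left (hinner y) (Real.exp_pos _).le
      _ ≤ Real.exp (((n * c ^ 2 / 4 : ℝ≥0) : ℝ) * t ^ 2 / 2)
            * Real.exp ((c : ℝ) ^ 2 / 4 * t ^ 2 / 2) := by
          rw [integral_mul_const]
          exact mul_le_mul_of_nonneg_right hih (Real.exp_pos _).le
      _ = _ := by
          rw [← Real.exp_add]
          congr 1
          push_cast
          ring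

/-! ### Symmetrization -/

theorem rademacher_neg {ι : Type*} {n : ℕ} (v : ι → Fin n → ℝ) :
    rademacher (fun i t => -v i t) = rademacher v := by
  unfold rademacher
  congr 1
  refine (Equiv.sum_comp (Equiv.arrowCongr (Equiv.refl (Fin n)) Equiv.boolNot)
    fun σ : Fin n → Bool => ⨆ i, ∑ t, sgn (σ t) * -v i t).symm.trans ?_
  refine Finset.sum_congr rfl fun σ _ => ?_
  congr 1
  funext i
  refine Finset.sum_congr rfl fun t _ => ?_
  simp only [Equiv.arrowCongr_apply, Equiv.coe_refl, Function.comp_apply, Equiv.refl_symm, id_eq,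
    Equiv.boolNot_apply]
  cases σ t <;> simp [sgn]

section

variable {ι Ω : Type*} [Finite ι] [Nonempty ι] [MeasurableSpace Ω] {n : ℕ}

theorem abs_iSup_le_of_forall {g : ι → ℝ} {C : ℝ} (h : ∀ i, |g i| ≤ C) : |⨆ i, g i| ≤ C := by
  obtain ⟨i, hi⟩ := exists_eq_ciSup_of_finite (f := g)
  rw [← hi]; exact h i

theorem iSup_le_iSup_add {g g' : ι → ℝ} {c : ℝ} (h : ∀ i, g i ≤ g' i + c) :
    ⨆ i, g i ≤ (⨆ i, g' i) + c :=
  ciSup_le fun i => (h i).trans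
    (add_le_add_left (le_ciSup (f := g') (Set.finite_range _).bddAbove i) c)

/-- **Symmetrization**: the expected uniform deviation of empirical means is at most twice the
Rademacher average, here bounded by `R` on almost every sample. The ghost sample is paired with
the sample, and the law of the pairs is invariant under swapping the members of any of them. -/
theorem integral_iSup_mean_sub_le {μ : Measure Ω} [IsProbabilityMeasure μ] {h : ι → Ω → ℝ}
    (hh : ∀ i, Measurable (h i)) {C : ℝ} (hC : ∀ i x, |h i x| ≤ C) (hn : 1 ≤ n) {R : ℝ}
    (hR : ∀ᵐ S ∂(Measure.pi fun _ : Fin n => μ), rademacher (fun i t => h i (S t)) ≤ R) :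
    ∫ S : Fin n → Ω, ⨆ i, (∫ x, h i x ∂μ - (1 / n : ℝ) * ∑ t, h i (S t))
      ∂(Measure.pi fun _ => μ) ≤ 2 * R / n := by
  set P := Measure.pi fun _ : Fin n => μ with hP
  set PP := Measure.pi fun _ : Fin n => μ.prod μ with hPP
  have hn0 : (0 : ℝ) < n := by exact_mod_cast hn
  -- the symmetrized deviation for a given choice of signs
  let Ψ : (Fin n → Bool) → (Fin n → Ω × Ω) → ℝ := fun σ p =>
    ⨆ i, ∑ t, sgn (σ t) * (h i (p t).2 - h i (p t).1)
  have hΨm : ∀ σ, Measurable (Ψ σ) := fun σ => Measurable.iSup fun i => by fun_prop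
  have hΨb : ∀ σ p, |Ψ σ p| ≤ n * (2 * C) := fun σ p => abs_iSup_le_of_forall fun i => by
    refine (Finset.abs_sum_le_sum_abs _ _).trans ?_
    calc ∑ t, |sgn (σ t) * (h i (p t).2 - h i (p t).1)| ≤ ∑ _t : Fin n, 2 * C := by
          gcongr with t
          rw [abs_mul, abs_sgn, one_mul]
          refine (abs_sub _ _).trans ?_
          linarith [hC i (p t).2, hC i (p t).1]
      _ = n * (2 * C) := by simp
  have hΨi : ∀ σ, Integrable (Ψ σ) PP := fun σ => integrable_of_forall_abs_le (hΨm σ) (hΨb σ)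
  have hswap : ∀ σ, ∫ p, Ψ σ p ∂PP = ∫ p, Ψ (fun _ => true) p ∂PP := by
    intro σ
    have hmp : MeasurePreserving
        (fun (p : Fin n → Ω × Ω) t => if σ t then p t else (p t).swap) PP PP := by
      refine measurePreserving_pi (fun _ => μ.prod μ) (fun _ => μ.prod μ)
        (f := fun t q => if σ t then q else q.swap) fun t => ?_
      cases σ t
      · simpa using Measure.measurePreserving_swap
      · simpa using! MeasurePreserving.id (μ.prod μ)
    have hcomp : ∫ p, Ψ (fun _ => true) p ∂PP
        = ∫ p, Ψ (fun _ => true) (fun t => if σ t then p t else (p t).swap) ∂PP := by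
      conv_lhs => rw [← hmp.map_eq]
      exact integral_map hmp.measurable.aemeasurable (hΨm _).aestronglyMeasurable
    rw [hcomp]
    congr 1
    funext p
    simp only [Ψ]
    congr 1
    funext i
    refine Finset.sum_congr rfl fun t _ => ?_
    cases σ t <;> simp [sgn]
  have hrad : ∫ p, Ψ (fun _ => true) p ∂PP ≤ 2 * R := by
    have e : ∫ p, Ψ (fun _ => true) p ∂PP = ∫ p, (∑ σ, Ψ σ p) / 2 ^ n ∂PP := by
      rw [integral_div, integral_finsetSum _ fun σ _ => hΨi σ]
      simp [hswap]
    rw [e]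
    have h1 := (measurePreserving_pi (fun _ : Fin n => μ.prod μ) (fun _ => μ)
      (f := fun _ => Prod.fst) fun _ => measurePreserving_fst).quasiMeasurePreserving.ae hR
    have h2 := (measurePreserving_pi (fun _ : Fin n => μ.prod μ) (fun _ => μ)
      (f := fun _ => Prod.snd) fun _ => measurePreserving_snd).quasiMeasurePreserving.ae hR
    have hle : ∀ᵐ p ∂PP, (∑ σ, Ψ σ p) / 2 ^ n ≤ 2 * R := by
      filter_upwards [h1, h2] with p hp1 hp2
      have := rademacher_add_le (fun i t => h i (p t).2) (fun i t => -h i (p t).1)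
      rw [rademacher_neg] at this
      have e : (∑ σ, Ψ σ p) / 2 ^ n
          = rademacher ((fun i t => h i (p t).2) + fun i t => -h i (p t).1) := by
        simp [rademacher, Ψ, sub_eq_add_neg]
      rw [e]
      linarith
    calc _ ≤ ∫ _p, 2 * R ∂PP :=
          integral_mono_ae ((integrable_finsetSum _ fun σ _ => hΨi σ).div_const _)
            (integrable_const _) hle
      _ = 2 * R := by simp
  let e := MeasurableEquiv.arrowProdEquivProdArrow Ω Ω (Fin n)
  have hmp : MeasurePreserving e PP (P.prod P) :=
    measurePreserving_arrowProdEquivProdArrow Ω Ω (Fin n) (fun _ => μ) fun _ => μ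
  let Φ : (Fin n → Ω) × (Fin n → Ω) → ℝ := fun q => ⨆ i, ∑ t, (h i (q.2 t) - h i (q.1 t))
  have hΦΨ : ∀ p, Φ (e p) = Ψ (fun _ => true) p := fun p => by
    simp only [Φ, Ψ, sgn, if_true, one_mul]
    rfl
  have hΦ : ∫ q, Φ q ∂(P.prod P) = ∫ p, Ψ (fun _ => true) p ∂PP := by
    rw [← hmp.integral_comp' (f := e)]
    simp only [hΦΨ]
  have hΦm : Measurable Φ := Measurable.iSup fun i => by fun_prop
  have hΦb : ∀ q, |Φ q| ≤ n * (2 * C) := fun q => by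
    have := hΦΨ (e.symm q)
    rw [e.apply_symm_apply] at this
    rw [this]; exact hΨb _ _
  have hΦi : Integrable Φ (P.prod P) := integrable_of_forall_abs_le hΦm hΦb
  have hhi : ∀ i t, Integrable (fun S : Fin n → Ω => h i (S t)) P := fun i t =>
    integrable_of_forall_abs_le (by fun_prop) fun S => hC i (S t)
  have hmean : ∀ i t, ∫ S : Fin n → Ω, h i (S t) ∂P = ∫ x, h i x ∂μ := fun i t =>
    integral_comp_eval (μ := fun _ : Fin n => μ) (i := t) (hh i).aestronglyMeasurable
  have hpt : ∀ S : Fin n → Ω, (⨆ i, (∫ x, h i x ∂μ - (1 / n : ℝ) * ∑ t, h i (S t)))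
      ≤ (∫ S', Φ (S, S') ∂P) / n := by
    intro S
    refine ciSup_le fun i => ?_
    have hsub : ∀ t, Integrable (fun S' : Fin n → Ω => h i (S' t) - h i (S t)) P := fun t =>
      (hhi i t).sub (integrable_const _)
    have hle : ∫ S', ∑ t, (h i (S' t) - h i (S t)) ∂P ≤ ∫ S', Φ (S, S') ∂P := by
      refine integral_mono (integrable_finsetSum _ fun t _ => hsub t)
        (integrable_of_forall_abs_le (by fun_prop) fun S' => hΦb (S, S')) fun S' => ?_
      exact le_ciSup (f := fun i => ∑ t, (h i (S' t) - h i (S t)))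
        (Set.finite_range _).bddAbove i
    rw [integral_finsetSum _ fun t _ => hsub t] at hle
    simp_rw [fun t => integral_sub (hhi i t) (integrable_const (h i (S t))), hmean] at hle
    rw [le_div_iff₀ hn0]
    refine le_trans (le_of_eq ?_) hle
    simp
    field_simp
  have hsupi : Integrable (fun S : Fin n → Ω =>
      ⨆ i, (∫ x, h i x ∂μ - (1 / n : ℝ) * ∑ t, h i (S t))) P := by
    refine integrable_of_forall_abs_le (C := C + (1 / n : ℝ) * (n * C))
      (Measurable.iSup fun i => by fun_prop) fun S => abs_iSup_le_of_forall fun i => ?_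
    refine (abs_sub _ _).trans (add_le_add ?_ ?_)
    · have := norm_integral_le_of_norm_le_const (μ := μ) (f := h i) (C := C)
        (Filter.Eventually.of_forall fun x => hC i x)
      simpa using this
    · rw [abs_mul, abs_of_pos (by positivity)]
      gcongr
      refine (Finset.abs_sum_le_sum_abs _ _).trans ?_
      exact (Finset.sum_le_sum fun t _ => hC i (S t)).trans_eq (by simp)
  calc _ ≤ ∫ S, (∫ S', Φ (S, S') ∂P) / n ∂P :=
        integral_mono hsupi (hΦi.integral_prod_left.div_const _) hpt
    _ = (∫ q, Φ q ∂(P.prod P)) / n := by rw [integral_div, integral_prod _ hΦi]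
    _ ≤ 2 * R / n := by rw [hΦ]; gcongr

end

/-! ### Uniform deviations, the law of the input tuples, and the tuple loss -/

/-- Uniform deviation of the empirical means of finitely many functions with values in `[0, b]`,
from the bound `R` on their Rademacher average. -/
theorem measure_exists_mean_gt_le {ι Ω : Type*} [Finite ι] [Nonempty ι] [MeasurableSpace Ω] {n : ℕ}
    {μ : Measure Ω} [IsProbabilityMeasure μ] {h : ι → Ω → ℝ} (hh : ∀ i, Measurable (h i))
    {b : ℝ} (hb : ∀ i x, h i x ∈ Set.Icc 0 b) (hn : 1 ≤ n) {R δ : ℝ}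
    (hR : ∀ᵐ S ∂(Measure.pi fun _ : Fin n => μ), rademacher (fun i t => h i (S t)) ≤ R)
    (hδ : δ ∈ Set.Ioo (0 : ℝ) 1) :
    (Measure.pi fun _ : Fin n => μ) {S | ∃ i, 3 * b * √(Real.log (2 / δ) / (2 * n)) + 2 * R / n
      < ∫ x, h i x ∂μ - (1 / n : ℝ) * ∑ t, h i (S t)} ≤ ENNReal.ofReal δ := by
  set P := Measure.pi fun _ : Fin n => μ with hP
  have hn0 : (0 : ℝ) < n := by exact_mod_cast hn
  have : Nonempty Ω := nonempty_of_isProbabilityMeasure μ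
  have hb0 : 0 ≤ b := by
    have := hb (Classical.arbitrary ι) (Classical.arbitrary Ω)
    exact this.1.trans this.2
  have habs : ∀ i x, |h i x| ≤ b := fun i x => by
    rw [abs_of_nonneg (hb i x).1]; exact (hb i x).2
  have hmean : ∀ i, |∫ x, h i x ∂μ| ≤ b := fun i => by
    have := norm_integral_le_of_norm_le_const (μ := μ) (f := h i) (C := b)
      (Filter.Eventually.of_forall fun x => habs i x)
    simpa using this
  let Z : (Fin n → Ω) → ℝ := fun S => ⨆ i, (∫ x, h i x ∂μ - (1 / n : ℝ) * ∑ t, h i (S t))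
  have hZm : Measurable Z := Measurable.iSup fun i => by fun_prop
  have hZb : ∀ S, |Z S| ≤ b + (1 / n : ℝ) * (n * b) := fun S => abs_iSup_le_of_forall fun i => by
    refine (abs_sub _ _).trans (add_le_add (hmean i) ?_)
    rw [abs_mul, abs_of_pos (by positivity)]
    gcongr
    refine (Finset.abs_sum_le_sum_abs _ _).trans ?_
    exact (Finset.sum_le_sum fun t _ => habs i (S t)).trans_eq (by simp)
  have hEZ : ∫ S, Z S ∂P ≤ 2 * R / n := integral_iSup_mean_sub_le hh habs hn hR
  set ε := 3 * b * √(Real.log (2 / δ) / (2 * n)) with hε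
  have hsub : {S : Fin n → Ω | ∃ i, ε + 2 * R / n < ∫ x, h i x ∂μ - (1 / n : ℝ) * ∑ t, h i (S t)}
      ⊆ {S | ε < Z S - ∫ S, Z S ∂P} := by
    rintro S ⟨i, hi⟩
    have : ∫ x, h i x ∂μ - (1 / n : ℝ) * ∑ t, h i (S t) ≤ Z S :=
      le_ciSup (f := fun i => ∫ x, h i x ∂μ - (1 / n : ℝ) * ∑ t, h i (S t))
        (Set.finite_range _).bddAbove i
    simp only [Set.mem_ofPred_eq]
    linarith
  refine (measure_mono hsub).trans ?_
  -- for `b = 0` the subgaussian tail bound degenerates, but all deviations vanish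
  rcases hb0.eq_or_lt with rfl | hbpos
  · have hz : ∀ S, Z S = 0 := fun S => by
      have h0 : |Z S| ≤ 0 := by simpa using hZb S
      simpa using h0
    simp [hz, hε]
  let c : ℝ≥0 := ⟨b / n, by positivity⟩
  have hc : ∀ S t y, |Z (Function.update S t y) - Z S| ≤ c := by
    have hone : ∀ S S' : Fin n → Ω, ∀ t, (∀ u ≠ t, S' u = S u) → Z S' ≤ Z S + c := by
      intro S S' t hS
      refine iSup_le_iSup_add fun i => ?_
      have e : ∑ u, h i (S u) - ∑ u, h i (S' u) = h i (S t) - h i (S' t) := by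
        rw [← Finset.sum_sub_distrib, Finset.sum_eq_single t]
        · intro u _ hu; rw [hS u hu, sub_self]
        · simp
      have h1 : h i (S t) - h i (S' t) ≤ b := by linarith [(hb i (S t)).2, (hb i (S' t)).1]
      have h2 : (1 / n : ℝ) * (∑ u, h i (S u) - ∑ u, h i (S' u)) ≤ 1 / n * b := by
        rw [e]; gcongr
      have h3 : (c : ℝ) = 1 / n * b := by change b / n = 1 / n * b; ring
      rw [h3]
      linarith
    intro S t y
    rw [abs_le]
    constructor
    · linarith [hone (Function.update S t y) S t fun u hu => (Function.update_of_ne hu _ _).symm]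
    · linarith [hone S (Function.update S t y) t fun u hu => Function.update_of_ne hu _ _]
  have hlog : 0 < Real.log (2 / δ) := Real.log_pos (by
    rw [lt_div_iff₀ hδ.1]; linarith [hδ.2])
  have htail := (hasSubgaussianMGF_of_bounded_differences μ hZm hZb hc).measure_ge_le
    (ε := ε) (by positivity)
  have hexp : Real.exp (-ε ^ 2 / (2 * ((n * c ^ 2 / 4 : ℝ≥0) : ℝ))) ≤ δ := by
    have hcc : (c : ℝ) = b / n := rfl
    have e : -ε ^ 2 / (2 * ((n * c ^ 2 / 4 : ℝ≥0) : ℝ)) = -(9 * Real.log (2 / δ)) := by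
      push_cast
      rw [hcc, hε, mul_pow, Real.sq_sqrt (by positivity)]
      field_simp
      ring
    rw [e]
    calc Real.exp (-(9 * Real.log (2 / δ))) ≤ Real.exp (Real.log δ) := by
          refine Real.exp_le_exp.2 ?_
          rw [Real.log_div (by norm_num) hδ.1.ne'] at hlog ⊢
          linarith [Real.log_pos (one_lt_two)]
      _ = δ := Real.exp_log hδ.1
  calc P {S | ε < Z S - ∫ S, Z S ∂P} ≤ P {S | ε ≤ Z S - ∫ S, Z S ∂P} :=
        measure_mono fun S hS => by
          simp only [Set.mem_ofPred_eq] at hS ⊢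
          exact hS.le
    _ = ENNReal.ofReal (P.real {S | ε ≤ Z S - ∫ S, Z S ∂P}) := by simp
    _ ≤ ENNReal.ofReal δ := ENNReal.ofReal_le_ofReal (htail.trans hexp)

section Law

variable {𝒞 : Type*} {m : ℕ} {ρ : PMF 𝒞} {D : 𝒞 → Measure (Euc m)}

theorem tsum_ne_zero_of_ne_one {c : 𝒞} (hc : ρ c ≠ 1) : ∑' z : {z : 𝒞 // z ≠ c}, ρ z ≠ 0 := by
  intro h
  refine hc ?_
  rw [← ρ.tsum_coe]
  refine (tsum_eq_single c fun z hz => ?_).symm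
  exact ENNReal.tsum_eq_zero.1 h ⟨z, hz⟩

theorem isProbabilityMeasure_negLaw (hD : ∀ c, IsProbabilityMeasure (D c)) {c : 𝒞}
    (hc : ρ c ≠ 1) : IsProbabilityMeasure (negLaw ρ D c) := by
  constructor
  have htop : ∑' z : {z : 𝒞 // z ≠ c}, ρ z ≠ ∞ :=
    ne_top_of_le_ne_top ENNReal.one_ne_top
      ((ENNReal.tsum_comp_le_tsum_of_injective Subtype.val_injective ρ).trans_eq ρ.tsum_coe)
  rw [negLaw, Measure.smul_apply, Measure.sum_apply _ MeasurableSet.univ]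
  simp only [Measure.smul_apply, measure_univ, smul_eq_mul, mul_one]
  exact ENNReal.inv_mul_cancel (tsum_ne_zero_of_ne_one hc) htop

theorem isProbabilityMeasure_tupleLaw (k : ℕ) (hD : ∀ c, IsProbabilityMeasure (D c))
    (hρ : ∀ c, ρ c ≠ 1) : IsProbabilityMeasure (tupleLaw k ρ D) := by
  constructor
  have := fun c => isProbabilityMeasure_negLaw hD (hρ c)
  rw [tupleLaw, Measure.sum_apply _ MeasurableSet.univ]
  simp only [Measure.smul_apply, measure_univ, smul_eq_mul, mul_one]
  exact ρ.tsum_coe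

/-- Inputs are almost surely bounded by `B`. The bound, unlike membership in `X`, is a measurable
condition, as is needed for the mixture over a possibly uncountable set of classes. -/
theorem ae_norm_le_tupleLaw (k : ℕ) (hD : ∀ c, IsProbabilityMeasure (D c)) (hρ : ∀ c, ρ c ≠ 1)
    {B : ℝ} (hB : ∀ c, ∀ᵐ x ∂(D c), ‖x‖ ≤ B) :
    ∀ᵐ t ∂(tupleLaw k ρ D), ‖t.1‖ ≤ B ∧ ‖t.2.1‖ ≤ B ∧ ∀ i, ‖t.2.2 i‖ ≤ B := by
  have hprob := fun c => isProbabilityMeasure_negLaw hD (hρ c)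
  have hneg : ∀ c, ∀ᵐ x ∂(negLaw ρ D c), ‖x‖ ≤ B := fun c => by
    refine Measure.ae_smul_measure ?_ _
    rw [Measure.ae_sum_iff' (measurableSet_le measurable_norm measurable_const)]
    exact fun z => Measure.ae_smul_measure (hB z) _
  have hm : MeasurableSet {t : InputTuple m k | ‖t.1‖ ≤ B ∧ ‖t.2.1‖ ≤ B ∧ ∀ i, ‖t.2.2 i‖ ≤ B} := by
    have h1 : MeasurableSet {t : InputTuple m k | ‖t.1‖ ≤ B} :=
      measurableSet_le (by fun_prop) measurable_const
    have h2 : MeasurableSet {t : InputTuple m k | ‖t.2.1‖ ≤ B} :=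
      measurableSet_le (by fun_prop) measurable_const
    have h3 : MeasurableSet (⋂ i, {t : InputTuple m k | ‖t.2.2 i‖ ≤ B}) :=
      MeasurableSet.iInter fun i => measurableSet_le (by fun_prop) measurable_const
    convert h1.inter (h2.inter h3) using 1
    ext t
    simp
  rw [tupleLaw, Measure.ae_sum_iff' hm]
  intro c
  refine Measure.ae_smul_measure ?_ _
  have h1 : ∀ᵐ t ∂((D c).prod ((D c).prod (Measure.pi fun _ : Fin k => negLaw ρ D c))),
      ‖t.1‖ ≤ B := Measure.quasiMeasurePreserving_fst.ae (hB c)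
  have h2 : ∀ᵐ t ∂((D c).prod ((D c).prod (Measure.pi fun _ : Fin k => negLaw ρ D c))),
      ‖t.2.1‖ ≤ B := Measure.quasiMeasurePreserving_snd.ae
        (Measure.quasiMeasurePreserving_fst.ae (hB c))
  have h3 : ∀ᵐ t ∂((D c).prod ((D c).prod (Measure.pi fun _ : Fin k => negLaw ρ D c))),
      ∀ i, ‖t.2.2 i‖ ≤ B := ae_all_iff.2 fun i => by
    have h := (Measure.quasiMeasurePreserving_eval (fun _ : Fin k => negLaw ρ D c) i).ae (hneg c)
    exact Measure.quasiMeasurePreserving_snd.ae (Measure.quasiMeasurePreserving_snd.ae h)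
  filter_upwards [h1, h2, h3] with t a b c using ⟨a, b, c⟩

end Law

section Loss

variable {m p k : ℕ} {loss : (Fin k → ℝ) → ℝ} {η : ℝ}

theorem continuous_loss (hloss : ∀ v w, |loss v - loss w| ≤ η * ‖v - w‖) (hη : 0 < η) :
    Continuous loss :=
  (LipschitzWith.of_dist_le_mul (K := ⟨η, hη.le⟩) fun v w => by
    rw [Real.dist_eq, dist_eq_norm]; exact hloss v w).continuous

theorem continuous_tupleLoss (hloss : Continuous loss) {f : Euc m → Euc p} (hf : Continuous f) :
    Continuous (tupleLoss (k := k) loss f) := by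
  unfold tupleLoss
  fun_prop

/-- The tuple loss is Lipschitz in the outputs: the inner products are bilinear and the outputs are
bounded by `R`. -/
theorem abs_tupleLoss_sub_le (hloss : ∀ v w, |loss v - loss w| ≤ η * ‖v - w‖) (hη : 0 < η)
    {f g : Euc m → Euc p} {t : InputTuple m k} {R e : ℝ} (hR : 0 ≤ R) (he : 0 ≤ e)
    (hf1 : ‖f t.2.1‖ ≤ R) (hf2 : ∀ i, ‖f (t.2.2 i)‖ ≤ R) (hg : ‖g t.1‖ ≤ R)
    (h0 : ‖f t.1 - g t.1‖ ≤ e) (h1 : ‖f t.2.1 - g t.2.1‖ ≤ e)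
    (h2 : ∀ i, ‖f (t.2.2 i) - g (t.2.2 i)‖ ≤ e) :
    |tupleLoss loss f t - tupleLoss loss g t| ≤ η * (4 * R * e) := by
  refine (hloss _ _).trans (mul_le_mul_of_nonneg_left ?_ hη.le)
  refine (pi_norm_le_iff_of_nonneg (by positivity)).2 fun i => ?_
  have e1 : inner ℝ (f t.1) (f t.2.1 - f (t.2.2 i)) - inner ℝ (g t.1) (g t.2.1 - g (t.2.2 i))
      = inner ℝ (f t.1 - g t.1) (f t.2.1 - f (t.2.2 i))
        + inner ℝ (g t.1) ((f t.2.1 - g t.2.1) - (f (t.2.2 i) - g (t.2.2 i))) := by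
    simp only [inner_sub_left, inner_sub_right]; ring
  rw [Pi.sub_apply, e1]
  have b1 : ‖f t.2.1 - f (t.2.2 i)‖ ≤ R + R := (norm_sub_le _ _).trans (add_le_add hf1 (hf2 i))
  have b2 : ‖(f t.2.1 - g t.2.1) - (f (t.2.2 i) - g (t.2.2 i))‖ ≤ e + e :=
    (norm_sub_le _ _).trans (add_le_add h1 (h2 i))
  calc _ ≤ ‖f t.1 - g t.1‖ * ‖f t.2.1 - f (t.2.2 i)‖
        + ‖g t.1‖ * ‖(f t.2.1 - g t.2.1) - (f (t.2.2 i) - g (t.2.2 i))‖ :=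
        (norm_add_le _ _).trans (add_le_add (norm_inner_le_norm _ _) (norm_inner_le_norm _ _))
    _ ≤ e * (R + R) + R * (e + e) := by gcongr
    _ = 4 * R * e := by ring

end Loss

section Continuity

variable {L : ℕ} {d : ℕ → ℕ} {act : ∀ l, Euc (d (l + 1)) → Euc (d (l + 1))}

theorem continuous_network (hact : ∀ l < L, Continuous (act l)) {l : ℕ} (hl : l ≤ L) :
    Continuous fun p : (∀ l, Matrix (Fin (d (l + 1))) (Fin (d l)) ℝ) × Euc (d 0) =>
      network d act p.1 l p.2 := by
  induction l with
  | zero => exact continuous_snd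
  | succ l ih =>
    have ih := ih (l.le_succ.trans hl)
    refine (hact l hl).comp ?_
    simp only [Matrix.toLpLin_apply]
    refine (PiLp.continuous_toLp 2 _).comp (Continuous.matrix_mulVec ?_ ?_)
    · exact (continuous_apply l).comp continuous_fst
    · exact (PiLp.continuous_ofLp 2 _).comp ih

end Continuity

/-! ### The Rademacher average of the loss class -/

section

variable {L : ℕ} {d : ℕ → ℕ} {act : ∀ l, Euc (d (l + 1)) → Euc (d (l + 1))} {lip : ℕ → ℝ≥0}
  {M : ∀ l, Matrix (Fin (d (l + 1))) (Fin (d l)) ℝ} {s a : ℕ → ℝ}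

/-- The loss vectors of the class on a sample are covered in the sup norm at every dyadic scale,
through a cover of the class on the `n (k + 2)` inputs that occur in the sample. -/
theorem exists_cover_tupleLoss {n k : ℕ} {loss : (Fin k → ℝ) → ℝ} {η : ℝ}
    (hlip : ∀ l < L, LipschitzWith (lip l) (act l))
    (hact : ∀ l < L, act l 0 = 0) (hs : ∀ l < L, 0 < s l) (ha : ∀ l < L, 0 < a l) (hL : 1 ≤ L)
    (hη : 0 < η) (hloss : ∀ v w, |loss v - loss w| ≤ η * ‖v - w‖) {B : ℝ} (hB : 0 ≤ B)
    {S : Fin n → InputTuple (d 0) k}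
    (hS : ∀ t, ‖(S t).1‖ ≤ B ∧ ‖(S t).2.1‖ ≤ B ∧ ∀ i, ‖(S t).2.2 i‖ ≤ B) (j : ℕ) :
    ∃ C : Finset (Fin n → ℝ),
      C.card ≤ (1 + maxWidth L d * (2 * (n * (k + 2)) + 1) ^ 4) ^ (4 ^ j / 2) ∧
      ∀ A : ∀ l, Matrix (Fin (d (l + 1))) (Fin (d l)) ℝ,
        (∀ m < L, A m ∈ layerSpace (M m) (s m) (a m)) → ∃ c ∈ C, ∀ t,
          |tupleLoss loss (network d act A L) (S t) - c t| ≤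
            32 * η * (B * ∏ m ∈ Finset.range L, (lip m * s m)) ^ 2 *
              (∑ l ∈ Finset.range L, a l ^ (2 / 3 : ℝ) / s l ^ (2 / 3 : ℝ)) ^ (3 / 2 : ℝ)
                / 2 ^ j := by
  classical
  let x : Fin (n * (k + 2)) → Euc (d 0) := fun u =>
    (Fin.cons (S (finProdFinEquiv.symm u).1).1
      (Fin.cons (S (finProdFinEquiv.symm u).1).2.1 (S (finProdFinEquiv.symm u).1).2.2
        : Fin (k + 1) → Euc (d 0)) : Fin (k + 2) → Euc (d 0)) (finProdFinEquiv.symm u).2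
  have hx0 : ∀ t, x (finProdFinEquiv (t, 0)) = (S t).1 := fun t => by
    simp only [x, Equiv.symm_apply_apply, Fin.cons_zero]
  have hx1 : ∀ t, x (finProdFinEquiv (t, 1)) = (S t).2.1 := fun t => by
    simp only [x, Equiv.symm_apply_apply]
    rfl
  have hx2 : ∀ t i, x (finProdFinEquiv (t, Fin.succ (Fin.succ i))) = (S t).2.2 i := fun t i => by
    simp only [x, Equiv.symm_apply_apply, Fin.cons_succ]
  have hx : ∀ u, ‖x u‖ ≤ B := fun u => by
    obtain ⟨⟨t, c⟩, rfl⟩ := finProdFinEquiv.surjective u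
    induction c using Fin.cases with
    | zero => rw [hx0]; exact (hS t).1
    | succ c =>
      induction c using Fin.cases with
      | zero => exact (congrArg norm (hx1 t)).trans_le (hS t).2.1
      | succ c => rw [hx2]; exact (hS t).2.2 c
  obtain ⟨𝒩, h𝒩S, h𝒩c, h𝒩⟩ :=
    exists_cover_network (M := M) hlip hact hs ha hL hB hx (4 ^ j / 2)
  set R := B * ∏ m ∈ Finset.range L, ((lip m : ℝ) * s m) with hRdef
  set T := (∑ l ∈ Finset.range L, a l ^ (2 / 3 : ℝ) / s l ^ (2 / 3 : ℝ)) ^ (3 / 2 : ℝ) with hT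
  have hR0 : 0 ≤ R := mul_nonneg hB (Finset.prod_nonneg fun m hm =>
    mul_nonneg (lip m).2 (hs m (Finset.mem_range.1 hm)).le)
  have hT0 : 0 ≤ T := Real.rpow_nonneg (Finset.sum_nonneg fun l hl =>
    div_nonneg (Real.rpow_nonneg (ha l (Finset.mem_range.1 hl)).le _)
      (Real.rpow_nonneg (hs l (Finset.mem_range.1 hl)).le _)) _
  have hsqrt : (2 : ℝ) ^ j / 2 ≤ √(((4 ^ j / 2 : ℕ) : ℝ) + 1 / 2) := by
    refine Real.le_sqrt_of_sq_le ?_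
    have h1 : 4 ^ j ≤ 2 * (4 ^ j / 2) + 1 := by omega
    have h2 : (4 : ℝ) ^ j ≤ 2 * ((4 ^ j / 2 : ℕ) : ℝ) + 1 := by exact_mod_cast h1
    have h3 : ((2 : ℝ) ^ j / 2) ^ 2 = 4 ^ j / 4 := by
      rw [div_pow, ← pow_mul, mul_comm j, pow_mul]; norm_num
    rw [h3]
    have : (0 : ℝ) < 4 ^ j := by positivity
    linarith
  have herr : 4 * R * T / √(((4 ^ j / 2 : ℕ) : ℝ) + 1 / 2) ≤ 8 * R * T / 2 ^ j := by
    calc 4 * R * T / √(((4 ^ j / 2 : ℕ) : ℝ) + 1 / 2) ≤ 4 * R * T / (2 ^ j / 2) := by gcongr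
      _ = 8 * R * T / 2 ^ j := by field_simp; ring
  refine ⟨𝒩.image fun A t => tupleLoss loss (network d act A L) (S t),
    Finset.card_image_le.trans h𝒩c, fun A hA => ?_⟩
  obtain ⟨A', hA', hAA'⟩ := h𝒩 A hA
  have hAA' : ∀ u, ‖network d act A L (x u) - network d act A' L (x u)‖ ≤ 8 * R * T / 2 ^ j :=
    fun u => (hAA' u).trans herr
  refine ⟨_, Finset.mem_image_of_mem _ hA', fun t => ?_⟩
  have hbd : ∀ A : ∀ l, Matrix (Fin (d (l + 1))) (Fin (d l)) ℝ,
      (∀ m < L, A m ∈ layerSpace (M m) (s m) (a m)) → ∀ y, ‖y‖ ≤ B →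
      ‖network d act A L y‖ ≤ R := fun A hA y hy =>
    norm_network_le hlip hact le_rfl (fun m hm => (hA m hm).1) hs hy
  refine (abs_tupleLoss_sub_le hloss hη hR0 (by positivity) (hbd A hA _ (hS t).2.1)
    (fun i => hbd A hA _ ((hS t).2.2 i)) (hbd A' (h𝒩S A' hA') _ (hS t).1)
    (hx0 t ▸ hAA' _) (hx1 t ▸ hAA' _) fun i => hx2 t i ▸ hAA' _).trans_eq ?_
  ring

/-- The entropy constant of a layer of width at most `W` on `N` points, with the two logarithms
separated. -/
theorem sqrt_two_mul_log_le {W N K : ℕ} (hW : 2 ≤ W) (hN : 2 ≤ N)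
    (hK : K = 1 + W * (2 * N + 1) ^ 4) :
    √(2 * Real.log K) ≤ 8 * (√(Real.log N) * Real.log W) := by
  have hKN : K ≤ W * N ^ 12 := by
    have h1 : (2 * N + 1) ^ 4 + 1 ≤ (N ^ 3) ^ 4 := by
      have h2 : 2 * N + 2 ≤ N ^ 3 := by nlinarith [Nat.pow_le_pow_left hN 2]
      calc (2 * N + 1) ^ 4 + 1 ≤ (2 * N + 2) ^ 4 :=
            Nat.pow_lt_pow_left (Nat.lt_succ_self _) (by norm_num)
        _ ≤ _ := Nat.pow_le_pow_left h2 4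
    have h3 : N ^ 12 = (N ^ 3) ^ 4 := by ring
    rw [hK, h3]
    nlinarith
  have hKpos : 0 < K := by omega
  have hWr : (2 : ℝ) ≤ W := by exact_mod_cast hW
  have hNr : (2 : ℝ) ≤ N := by exact_mod_cast hN
  have hl2 : 0.69 < Real.log 2 := by linarith [Real.log_two_gt_d9]
  have hlW : 0.69 < Real.log W := hl2.trans_le (Real.log_le_log (by norm_num) hWr)
  have hlN : 0.69 < Real.log N := hl2.trans_le (Real.log_le_log (by norm_num) hNr)
  have hlK : Real.log K ≤ Real.log W + 12 * Real.log N := by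
    calc Real.log K ≤ Real.log (W * N ^ 12) :=
          Real.log_le_log (by exact_mod_cast hKpos) (by exact_mod_cast hKN)
      _ = _ := by
          rw [Real.log_mul (by positivity) (by positivity), Real.log_pow]; norm_num
  have hfin : 2 * Real.log K ≤ (8 * (√(Real.log N) * Real.log W)) ^ 2 := by
    rw [mul_pow, mul_pow, Real.sq_sqrt (by linarith)]
    nlinarith [mul_pos (sub_pos.2 hlW) (sub_pos.2 hlN),
      mul_pos (mul_pos (sub_pos.2 hlW) (sub_pos.2 hlN)) (sub_pos.2 hlW),
      mul_pos (sub_pos.2 hlW) (sub_pos.2 hlW)]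
  exact (Real.sqrt_le_sqrt hfin).trans_eq (Real.sqrt_sq (by positivity))

theorem clog_two_le {n : ℕ} (hn : 1 ≤ n) : (Nat.clog 2 n : ℝ) ≤ 3 * Real.log (n + 1) := by
  have hl2 : 0.69 < Real.log 2 := by linarith [Real.log_two_gt_d9]
  have hnr : (1 : ℝ) ≤ n := by exact_mod_cast hn
  have hlog : Real.log 2 ≤ Real.log (n + 1) := Real.log_le_log (by norm_num) (by linarith)
  rcases hn.eq_or_lt with rfl | hn
  · have := hl2.trans_le hlog
    simp only [Nat.clog_one_right, CharP.cast_eq_zero]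
    linarith
  have h1 := Nat.pow_pred_clog_lt_self one_lt_two hn
  have h2 : ((Nat.clog 2 n).pred : ℝ) * Real.log 2 ≤ Real.log (n + 1) := by
    rw [← Real.log_pow]
    refine Real.log_le_log (by positivity) ?_
    have : ((2 ^ (Nat.clog 2 n).pred : ℕ) : ℝ) < n := by exact_mod_cast h1
    push_cast at this
    linarith
  have h3 : (Nat.clog 2 n : ℝ) ≤ (Nat.clog 2 n).pred + 1 := by
    have h4 : Nat.clog 2 n ≤ (Nat.clog 2 n).pred + 1 := by rw [Nat.pred_eq_sub_one]; omega
    exact_mod_cast h4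
  nlinarith

/-- The Rademacher average of the loss class on a sample of bounded inputs. -/
theorem rademacher_tupleLoss_le {ι : Type*} [Finite ι] [Nonempty ι] {n k : ℕ}
    {loss : (Fin k → ℝ) → ℝ} {η : ℝ} (hlip : ∀ l < L, LipschitzWith (lip l) (act l))
    (hact : ∀ l < L, act l 0 = 0) (hs : ∀ l < L, 0 < s l) (ha : ∀ l < L, 0 < a l) (hL : 1 ≤ L)
    (hn : 1 ≤ n) (hη : 0 < η) (hloss : ∀ v w, |loss v - loss w| ≤ η * ‖v - w‖) {B : ℝ}
    (hB : 0 ≤ B) {S : Fin n → InputTuple (d 0) k}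
    (hS : ∀ t, ‖(S t).1‖ ≤ B ∧ ‖(S t).2.1‖ ≤ B ∧ ∀ i, ‖(S t).2.2 i‖ ≤ B)
    (A : ι → ∀ l, Matrix (Fin (d (l + 1))) (Fin (d l)) ℝ)
    (hA : ∀ i, ∀ m < L, A i m ∈ layerSpace (M m) (s m) (a m)) :
    rademacher (fun i t => tupleLoss loss (network d act (A i) L) (S t)) ≤
      2400 * (√(Real.log (n * (k + 2))) * Real.log (n + 1)) *
        (η * B ^ 2 * √n * Real.log (max (maxWidth L d) 2) *
          (∏ l ∈ Finset.range L, (lip l : ℝ) ^ 2 * s l ^ 2) *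
          (∑ l ∈ Finset.range L, a l ^ (2 / 3 : ℝ) / s l ^ (2 / 3 : ℝ)) ^ (3 / 2 : ℝ)) := by
  set T := (∑ l ∈ Finset.range L, a l ^ (2 / 3 : ℝ) / s l ^ (2 / 3 : ℝ)) ^ (3 / 2 : ℝ) with hT
  set R := B * ∏ m ∈ Finset.range L, ((lip m : ℝ) * s m) with hRdef
  have hT0 : 0 ≤ T := Real.rpow_nonneg (Finset.sum_nonneg fun l hl =>
    div_nonneg (Real.rpow_nonneg (ha l (Finset.mem_range.1 hl)).le _)
      (Real.rpow_nonneg (hs l (Finset.mem_range.1 hl)).le _)) _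
  have hR2 : R ^ 2 = B ^ 2 * ∏ l ∈ Finset.range L, (lip l : ℝ) ^ 2 * s l ^ 2 := by
    rw [hRdef, mul_pow, ← Finset.prod_pow]
    simp only [mul_pow]
  set N := n * (k + 2) with hN
  have hN2 : 2 ≤ N := by
    calc 2 = 1 * 2 := rfl
      _ ≤ n * (k + 2) := Nat.mul_le_mul hn (by omega)
  set W := max (maxWidth L d) 2 with hW
  have hW2 : 2 ≤ W := le_max_right _ _
  set K := 1 + W * (2 * N + 1) ^ 4 with hK
  have hK2 : 2 ≤ K := by
    have : 0 < W * (2 * N + 1) ^ 4 := Nat.mul_pos (by omega) (by positivity)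
    omega
  set G := 32 * η * R ^ 2 * T with hG
  have hG0 : 0 ≤ G := by positivity
  have hcov : ∀ j : ℕ, ∃ C : Finset (Fin n → ℝ), C.card ≤ K ^ (4 ^ j / 2) ∧
      ∀ i, ∃ c ∈ C, ∀ t,
        |tupleLoss loss (network d act (A i) L) (S t) - c t| ≤ G / 2 ^ j := by
    intro j
    obtain ⟨C, hC1, hC2⟩ :=
      exists_cover_tupleLoss (M := M) hlip hact hs ha hL hη hloss hB hS j
    refine ⟨C, hC1.trans (Nat.pow_le_pow_left ?_ _), fun i => hC2 _ (hA i)⟩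
    exact Nat.add_le_add_left (Nat.mul_le_mul_right _ (le_max_left _ _)) _
  have hnr : (1 : ℝ) ≤ n := by exact_mod_cast hn
  have hl2 : 0.69 < Real.log 2 := by linarith [Real.log_two_gt_d9]
  have hlW : 0.69 < Real.log W :=
    hl2.trans_le (Real.log_le_log (by norm_num) (by exact_mod_cast hW2))
  have hlN : 0.69 < Real.log N :=
    hl2.trans_le (Real.log_le_log (by norm_num) (by exact_mod_cast hN2))
  have hln : 0.69 < Real.log (n + 1) :=
    hl2.trans_le (Real.log_le_log (by norm_num) (by linarith))
  have hsN : 0.8 ≤ √(Real.log N) := Real.le_sqrt_of_sq_le (by norm_num at hlN ⊢; linarith)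
  have hsn : 1 ≤ √(n : ℝ) := by rw [Real.one_le_sqrt]; exact hnr
  have hpow : (n : ℝ) * (G / 2 ^ Nat.clog 2 n) ≤ G := by
    have h1 : ((n : ℕ) : ℝ) ≤ 2 ^ Nat.clog 2 n := by
      exact_mod_cast Nat.le_pow_clog one_lt_two n
    rw [mul_div_assoc', div_le_iff₀ (by positivity), mul_comm]
    gcongr
  set X := √(Real.log N) * Real.log W * Real.log (n + 1) with hX
  -- all three logarithmic factors are bounded below, since `n (k + 2)`, `W` and `n + 1`
  -- are at least `2`
  have hX1 : 1 ≤ 3 * X := by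
    have h1 : (0.8 : ℝ) * 0.69 * 0.69 ≤ X := by rw [hX]; gcongr
    norm_num at h1 ⊢
    linarith
  -- `clog 2 n` scales bring the residual term `n G / 2 ^ J` down to `G`
  calc _ ≤ (Nat.clog 2 n : ℝ) * (3 * G * √n * √(2 * Real.log K))
        + n * (G / 2 ^ Nat.clog 2 n) := rademacher_le_of_covers hK2 hG0 hcov _
    _ ≤ 3 * Real.log (n + 1) * (3 * G * √n * (8 * (√(Real.log N) * Real.log W)))
        + G * √n * (3 * X) := by
        refine add_le_add ?_ ?_
        · gcongr
          · exact clog_two_le hn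
          · exact sqrt_two_mul_log_le hW2 hN2 hK
        · refine hpow.trans ?_
          calc G = G * 1 * 1 := by ring
            _ ≤ G * √n * (3 * X) := by gcongr
    _ = 75 * (G * √n * X) := by rw [hX]; ring
    _ = _ := by
        have e1 : ((N : ℕ) : ℝ) = n * (k + 2) := by rw [hN]; push_cast; ring
        have e2 : ((W : ℕ) : ℝ) = max (maxWidth L d : ℝ) 2 := by rw [hW]; push_cast; rfl
        rw [hX, hG, hR2, e1, e2]; ring

end

instance {p q : ℕ} : SecondCountableTopology (Matrix (Fin p) (Fin q) ℝ) :=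
  inferInstanceAs (SecondCountableTopology (Fin p → Fin q → ℝ))

end DCRL

end

/-! ### The generalization bound -/

open DCRL in
theorem theorem1 :
    ∃ C : ℝ, 0 < C ∧
      ∀ (𝒞 : Type*) (L n k : ℕ) (d : ℕ → ℕ)
        (X : Set (Euc (d 0))) (ρ : PMF 𝒞) (D : 𝒞 → Measure (Euc (d 0)))
        (act : ∀ l, Euc (d (l + 1)) → Euc (d (l + 1))) (lip : ℕ → ℝ≥0)
        (M : ∀ l, Matrix (Fin (d (l + 1))) (Fin (d l)) ℝ) (s a : ℕ → ℝ)
        (loss : (Fin k → ℝ) → ℝ) (Mb η δ : ℝ),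
      1 ≤ L → 1 ≤ n →
      -- the data: bounded input space, class-conditional laws on it, at least two classes
      Bornology.IsBounded X →
      (∀ c, IsProbabilityMeasure (D c)) → (∀ c, ∀ᵐ x ∂(D c), x ∈ X) →
      (∀ c, ρ c ≠ 1) →
      -- the networks
      (∀ l < L, LipschitzWith (lip l) (act l)) → (∀ l < L, act l 0 = 0) →
      (∀ l < L, 0 < s l) → (∀ l < L, 0 < a l) →
      -- the loss
      (∀ v, loss v ∈ Set.Icc 0 Mb) → 0 < η →
      (∀ v w, |loss v - loss w| ≤ η * ‖v - w‖) →
      δ ∈ Set.Ioo (0 : ℝ) 1 →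
      -- with probability at least `1 - δ` the bound holds for all networks of the class
      (Measure.pi fun _ : Fin n => tupleLaw k ρ D)
        {S | ¬ ∀ f ∈ networkClass L d act M s a,
          popRisk ρ D loss f - empRisk loss f S ≤
            3 * Mb * √(Real.log (2 / δ) / (2 * n)) +
              C * (√(Real.log (n * (k + 2))) * Real.log (n + 1)) *
                (η * (⨆ x : X, ‖(x : Euc (d 0))‖) ^ 2 / √n *
                  Real.log (max (maxWidth L d) 2) *
                  (∏ l ∈ Finset.range L, (lip l : ℝ) ^ 2 * s l ^ 2) *
                  (∑ l ∈ Finset.range L, a l ^ (2 / 3 : ℝ) / s l ^ (2 / 3 : ℝ)) ^ (3 / 2 : ℝ))}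
        ≤ ENNReal.ofReal δ := by
  refine ⟨4800, by norm_num, ?_⟩
  intro 𝒞 L n k d X ρ D act lip M s a loss Mb η δ hL hn hX hD hDX hρ hlip hact hs ha hb hη
    hloss hδ
  have hprob := isProbabilityMeasure_tupleLaw k hD hρ
  set B := ⨆ x : X, ‖(x : Euc (d 0))‖ with hBdef
  have hB0 : 0 ≤ B := Real.iSup_nonneg fun x => norm_nonneg _
  have hB : ∀ x ∈ X, ‖x‖ ≤ B := fun x hx => by
    obtain ⟨r, hr⟩ := hX.exists_norm_le
    exact le_ciSup (f := fun x : X => ‖(x : Euc (d 0))‖)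
      ⟨r, by rintro _ ⟨y, rfl⟩; exact hr y y.2⟩ ⟨x, hx⟩
  have hsupp := ae_norm_le_tupleLaw k hD hρ fun c => (hDX c).mono hB
  set P := Measure.pi fun _ : Fin n => tupleLaw k ρ D with hP
  have hsuppS : ∀ᵐ S ∂P, ∀ t, ‖(S t).1‖ ≤ B ∧ ‖(S t).2.1‖ ≤ B ∧ ∀ i, ‖(S t).2.2 i‖ ≤ B :=
    ae_all_iff.2 fun t =>
      (Measure.quasiMeasurePreserving_eval (fun _ : Fin n => tupleLaw k ρ D) t).ae hsupp
  set β : ℝ := 3 * Mb * √(Real.log (2 / δ) / (2 * n)) +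
    4800 * (√(Real.log (n * (k + 2))) * Real.log (n + 1)) *
      (η * B ^ 2 / √n * Real.log (max (maxWidth L d) 2) *
        (∏ l ∈ Finset.range L, (lip l : ℝ) ^ 2 * s l ^ 2) *
        (∑ l ∈ Finset.range L, a l ^ (2 / 3 : ℝ) / s l ^ (2 / 3 : ℝ)) ^ (3 / 2 : ℝ)) with hβ
  let 𝒜 : Set (∀ l, Matrix (Fin (d (l + 1))) (Fin (d l)) ℝ) :=
    {A | ∀ l < L, A l ∈ layerSpace (M l) (s l) (a l)}
  have hlossc : Continuous loss := continuous_loss hloss hη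
  have hnet := continuous_network (d := d) (fun l hl => (hlip l hl).continuous) le_rfl
  have hnetx : ∀ A, Continuous (network d act A L) := fun A => by
    exact hnet.comp (Continuous.prodMk_right A)
  have hnetA : ∀ x, Continuous fun A => network d act A L x := fun x => by
    exact hnet.comp (Continuous.prodMk_left x)
  have hmeas : ∀ A, Measurable (tupleLoss (k := k) loss (network d act A L)) := fun A =>
    (continuous_tupleLoss hlossc (hnetx A)).measurable
  have htlA : ∀ t : InputTuple (d 0) k,
      Continuous fun A => tupleLoss loss (network d act A L) t := by
    intro t
    unfold tupleLoss
    exact hlossc.comp (continuous_pi fun i =>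
      (hnetA _).inner ((hnetA _).sub (hnetA _)))
  have htlb : ∀ A (t : InputTuple (d 0) k), ‖tupleLoss loss (network d act A L) t‖ ≤ Mb :=
    fun A t => by
      have h := hb fun i => inner ℝ (network d act A L t.1)
        (network d act A L t.2.1 - network d act A L (t.2.2 i))
      exact (abs_of_nonneg h.1).trans_le h.2
  have hpop : Continuous fun A => popRisk ρ D loss (network d act A L) :=
    continuous_of_dominated (fun A => (hmeas A).aestronglyMeasurable)
      (fun A => Filter.Eventually.of_forall (htlb A)) (integrable_const Mb)
      (Filter.Eventually.of_forall htlA)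
  have hdev : ∀ S : Fin n → InputTuple (d 0) k, Continuous fun A =>
      popRisk ρ D loss (network d act A L)
      - empRisk loss (network d act A L) S := by
    intro S
    exact hpop.sub (continuous_const.mul (continuous_finsetSum _ fun j _ => htlA (S j)))
  rcases 𝒜.eq_empty_or_nonempty with hempty | ⟨A₀, hA₀⟩
  · have : {S : Fin n → InputTuple (d 0) k | ¬ ∀ f ∈ networkClass L d act M s a,
        popRisk ρ D loss f - empRisk loss f S ≤ β} = ∅ := by
      ext S
      simp only [Set.mem_ofPred_eq, Set.mem_empty_iff_false, iff_false, not_not]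
      rintro f ⟨A, hA, -⟩
      exact absurd (show A ∈ 𝒜 from hA) (by simp [hempty])
    rw [this]; simp
  have : Nonempty 𝒜 := ⟨⟨A₀, hA₀⟩⟩
  -- by continuity in the weights, a countable dense set of networks decides the event
  let w : ℕ → 𝒜 := TopologicalSpace.denseSeq 𝒜
  have hbad : {S : Fin n → InputTuple (d 0) k | ¬ ∀ f ∈ networkClass L d act M s a,
        popRisk ρ D loss f - empRisk loss f S ≤ β}
      ⊆ ⋃ i, {S | β < popRisk ρ D loss (network d act (w i) L)
          - empRisk loss (network d act (w i) L) S} := by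
    intro S hS
    simp only [Set.mem_ofPred_eq, not_forall, not_le] at hS
    obtain ⟨f, ⟨A, hA, rfl⟩, hlt⟩ := hS
    have hopen : IsOpen {A : 𝒜 | β < popRisk ρ D loss (network d act A L)
        - empRisk loss (network d act A L) S} :=
      isOpen_lt continuous_const ((hdev S).comp continuous_subtype_val)
    obtain ⟨i, hi⟩ := (TopologicalSpace.denseRange_denseSeq 𝒜).exists_mem_open hopen
      ⟨⟨A, hA⟩, hlt⟩
    exact Set.mem_iUnion.2 ⟨i, hi⟩
  refine (measure_mono hbad).trans ?_
  rw [measure_iUnion_eq_iSup_accumulate]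
  refine iSup_le fun i => ?_
  -- the accumulated events involve finitely many networks, to which McDiarmid's inequality applies
  let h : Fin (i + 1) → InputTuple (d 0) k → ℝ := fun r t =>
    tupleLoss loss (network d act (w r) L) t
  have hR : ∀ᵐ S ∂P, rademacher (fun r t => h r (S t)) ≤
      2400 * (√(Real.log (n * (k + 2))) * Real.log (n + 1)) *
        (η * B ^ 2 * √n * Real.log (max (maxWidth L d) 2) *
          (∏ l ∈ Finset.range L, (lip l : ℝ) ^ 2 * s l ^ 2) *
          (∑ l ∈ Finset.range L, a l ^ (2 / 3 : ℝ) / s l ^ (2 / 3 : ℝ)) ^ (3 / 2 : ℝ)) := by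
    filter_upwards [hsuppS] with S hS
    exact rademacher_tupleLoss_le (M := M) hlip hact hs ha hL hn hη hloss hB0 hS
      (fun r : Fin (i + 1) => (w r : ∀ l, Matrix (Fin (d (l + 1))) (Fin (d l)) ℝ))
      fun r => (w r).2
  refine (measure_mono ?_).trans
    (measure_exists_mean_gt_le (h := h) (fun r => hmeas _) (fun r t => hb _) hn hR hδ)
  intro S hS
  obtain ⟨r, hr, hlt⟩ := Set.mem_accumulate.1 hS
  refine ⟨⟨r, Nat.lt_succ_of_le hr⟩, lt_of_eq_of_lt ?_ hlt⟩
  have hn0 : (0 : ℝ) < n := by exact_mod_cast hn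
  have hsq : √(n : ℝ) / n = 1 / √n := by
    rw [div_eq_div_iff hn0.ne' (Real.sqrt_pos.2 hn0).ne', Real.mul_self_sqrt hn0.le, one_mul]
  rw [hβ]
  congr 1
  simp only [div_eq_mul_inv, one_mul] at hsq ⊢
  rw [← hsq]
  ring
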